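/- Let $(W,S)$ be a Coxeter system of finite rank with Coxeter matrix $(m_{r,s})_{r,s\in S}$, and let $\Gamma$ be its Coxeter graph: its vertex set is $S$, and distinct $r,s$ are joined by an edge iff $m_{r,s}\ge 3$ or $m_{r,s}=\infty$. Let $P$ be the path algebra $\mathbb{Z}\Gamma$, whose $\mathbb{Z}$-basis consists of the paths $[s_1\cdots s_n]$ ($n\ge 1$) in $\Gamma$, multiplied by concatenation. For $m\ge 3$ let $C_m(t)\in\mathbb{Z}[t]$ be the minimal polynomial of $4\cos^2(\pi/m)$. Let $R_{W,S}$ be the quotient of $P$ by the two-sided ideal generated by the elements $C_{m_{r,s}}([rsr])\in [r]P[r]$ for $r,s\in S$ with $3\le m_{r,s}<\infty$, where $[r]P[r]$ has identity element $[r]$, and put $R'=R_{W,S}\otimes_{\mathbb{Z}}\mathbb{R}$. On $R_{W,S}$, and by base change on $R'$, $W$ acts from the left right-linearly and from the right left-linearly, and for $r,s\in S$ $$s[s]=-[s]=[s]s,\qquad s[r]=[r]+[sr],\quad [r]s=[r]+[rs]\quad (r\ne s),$$ where $[rs]:=0$ if $m_{r,s}=2$. These actions commute, so $R'$ is a $W\times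 W^{\mathrm{op}}$-set. A strict real reflection matrix for $(W,S)$ is a real matrix $A=(a_{r,s})_{r,s\in S}$ such that $a_{s,s}=2$ for all $s$; $a_{r,s}=0$ if $m_{r,s}=2$; and if $3\le m_{r,s}<\infty$, then $a_{r,s}a_{s,r}=4\cos^2(k\pi/m_{r,s})$ for some integer $k$ coprime to $m_{r,s}$ with $1\le k\le m_{r,s}/2$. Let $V_A$ and $\check V_A$ be real vector spaces with bases $(\alpha_s)_{s\in S}$ and $(\check\alpha_s)_{s\in S}$, with the $W$-actions such that $s\alpha_r=\alpha_r-a_{r,s}\alpha_s$ and $s\check\alpha_r=\check\alpha_r-a_{s,r}\check\alpha_s$. Regard $V_A$ as a right $W$-set by $vw=w^{-1}v$, so that $W\times W^{\mathrm{op}}$ acts on $\check V_A\otimes_{\mathbb{R}}V_A$. Let $W\times W^{\mathrm{op}}$ act on $B=\mathrm{Mat}_{S\times S}(\mathbb{R})$, which has matrix units $e_{r,s}$, through the linear identification $\check V_A\otimes_{\mathbb{R}} V_A= B$ with $\check\alpha_r\otimes\alpha_s=e_{r,s}$. (1) Suppose that $W$ is an irreducible finite Weyl group with Cartan matrix $A$;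 that is, $W$ is finite, $\Gamma$ is connected (and non-empty), and $A$ is an integral matrix with $a_{s,s}=2$, $a_{r,s}\le 0$ for $r\ne s$, $a_{r,s}=0$ if $m_{r,s}=2$, $a_{r,s}a_{s,r}=4\cos^2(\pi/m_{r,s})$ if $3\le m_{r,s}<\infty$, and $a_{r,s}a_{s,r}\ge 4$ if $m_{r,s}=\infty$. Then $R'$ and $B$ are $W\times W^{\mathrm{op}}$-equivariantly isomorphic as $\mathbb{R}$-algebras. Thus, as a $W\times W^{\mathrm{op}}$-representation, $R'\cong B=\check V_A\otimes_{\mathbb{R}}V_A$. (2) More generally, the same holds for every strict real reflection matrix $A$ for $(W,S)$ if $\Gamma$ is a tree and $m_{r,s}\in\{2,3,4,6\}$ for all $r\ne s$ in $S$. -/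

import Mathlib

open Polynomial
open scoped TensorProduct

namespace StrictReflection

/-! ### Path algebras -/

section PathAlgebra

variable {V : Type*}

/-- A path of finite length in the graph `G`: a walk together with its origin and its terminus. -/
structure GraphPath (G : SimpleGraph V) where
  o : V
  t : V
  walk : G.Walk o t

/-- The path algebra of the graph `G` over `k`: the free `k`-module with basis the paths of `G`,
with multiplication given by concatenation of paths. -/
def PathAlgebra (k : Type*) [CommRing k] (G : SimpleGraph V) : Type _ := GraphPath G →₀ k

variable (k : Type*) [CommRing k] {G : SimpleGraph V}

noncomputable instance : AddCommGroup (PathAlgebra k G) :=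
  inferInstanceAs (AddCommGroup (GraphPath G →₀ k))

open Classical in
/-- The product of two paths: the concatenated path if the first ends where the second starts,
and `0` otherwise. -/
noncomputable def pathMul (p q : GraphPath G) : GraphPath G →₀ k :=
  if h : p.t = q.o then Finsupp.single ⟨p.o, q.t, p.walk.append (q.walk.copy h.symm rfl)⟩ 1 else 0

/-- The bilinear extension of `pathMul`. -/
noncomputable def pathMulBilin :
    (GraphPath G →₀ k) →ₗ[k] (GraphPath G →₀ k) →ₗ[k] (GraphPath G →₀ k) :=
  Finsupp.lift _ k _ fun p => Finsupp.lift _ k _ fun q => pathMul k p q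

theorem pathMulBilin_single (p q : GraphPath G) :
    pathMulBilin k (Finsupp.single p 1) (Finsupp.single q 1) = pathMul k p q := by
  simp [pathMulBilin]

theorem pathMulBilin_assoc (x y z : GraphPath G →₀ k) :
    pathMulBilin k (pathMulBilin k x y) z = pathMulBilin k x (pathMulBilin k y z) := by
  have key : ∀ p q r : GraphPath G,
      pathMulBilin k (pathMul k p q) (Finsupp.single r 1)
        = pathMulBilin k (Finsupp.single p 1) (pathMul k q r) := by
    rintro ⟨a, b, p⟩ ⟨c, d, q⟩ ⟨e, f, r⟩
    by_cases h1 : b = c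
    · subst h1
      by_cases h2 : d = e
      · subst h2
        simp [pathMul, pathMulBilin_single, SimpleGraph.Walk.append_assoc]
      · simp [pathMul, pathMulBilin_single, h2]
    · by_cases h2 : d = e
      · subst h2
        simp [pathMul, pathMulBilin_single, h1]
      · simp [pathMul, h1, h2]
  induction x using Finsupp.induction_linear with
  | zero => simp
  | add x x' hx hx' => simp only [map_add, LinearMap.add_apply, hx, hx']
  | single p a =>
    induction y using Finsupp.induction_linear with
    | zero => simp
    | add y y' hy hy' => simp only [map_add, LinearMap.add_apply, hy, hy']
    | single q b =>
      induction z using Finsupp.induction_linear with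
      | zero => simp
      | add z z' hz hz' => simp only [map_add, hz, hz']
      | single r c =>
        rw [← mul_one a, ← mul_one b, ← mul_one c, ← smul_eq_mul, ← smul_eq_mul, ← smul_eq_mul,
          ← Finsupp.smul_single, ← Finsupp.smul_single, ← Finsupp.smul_single]
        simp only [map_smul, LinearMap.smul_apply, pathMulBilin_single, key]

noncomputable instance : NonUnitalRing (PathAlgebra k G) where
  mul x y := pathMulBilin k x y
  left_distrib x y z := map_add (pathMulBilin k x) y z
  right_distrib x y z := by
    exact LinearMap.congr_fun (map_add (pathMulBilin k) (show GraphPath G →₀ k from x)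
      (show GraphPath G →₀ k from y)) z
  zero_mul x := by
    exact LinearMap.congr_fun (map_zero (pathMulBilin k)) x
  mul_zero x := map_zero (pathMulBilin k x)
  mul_assoc := pathMulBilin_assoc k

/-- The basis element of the path algebra given by a path. -/
noncomputable def ofPath (p : GraphPath G) : PathAlgebra k G :=
  (Finsupp.single p 1 : GraphPath G →₀ k)

/-- The basis element `[v]` given by the path of length zero at `v`. -/
noncomputable def vertex (v : V) : PathAlgebra k G := ofPath k ⟨v, v, .nil⟩

open Classical in
/-- The basis element `[v w]` given by the path of length one from `v` to `w`, if `v` and `w` are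
adjacent, and `0` otherwise. -/
noncomputable def edge (v w : V) : PathAlgebra k G :=
  if h : G.Adj v w then ofPath k ⟨v, w, .cons h .nil⟩ else 0

theorem ofPath_mul (p q : GraphPath G) : ofPath k p * ofPath k q = pathMul k p q :=
  pathMulBilin_single k p q

theorem vertex_mul_ofPath (v : V) (p : GraphPath G) (h : v = p.o) :
    vertex k v * ofPath k p = ofPath k p := by
  obtain ⟨a, b, p⟩ := p
  subst h
  rw [vertex, ofPath_mul]
  simp [pathMul]; rfl

theorem vertex_mul_ofPath_of_ne (v : V) (p : GraphPath G) (h : v ≠ p.o) :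
    vertex k v * ofPath k p = 0 := by
  rw [vertex, ofPath_mul]
  simp [pathMul, h]; rfl

theorem ofPath_mul_vertex (v : V) (p : GraphPath G) (h : p.t = v) :
    ofPath k p * vertex k v = ofPath k p := by
  obtain ⟨a, b, p⟩ := p
  subst h
  rw [vertex, ofPath_mul]
  simp [pathMul]; rfl

theorem ofPath_mul_vertex_of_ne (v : V) (p : GraphPath G) (h : p.t ≠ v) :
    ofPath k p * vertex k v = 0 := by
  rw [vertex, ofPath_mul]
  simp [pathMul, h]; rfl

theorem pathMulBilin_one_left [Fintype V] (x : GraphPath G →₀ k) :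
    pathMulBilin k (∑ v, Finsupp.single ⟨v, v, .nil⟩ 1) x = x := by
  induction x using Finsupp.induction_linear with
  | zero => simp
  | add x y hx hy => rw [map_add, hx, hy]
  | single p c =>
    rw [← mul_one c, ← smul_eq_mul, ← Finsupp.smul_single, map_smul, map_sum,
      LinearMap.sum_apply, Finset.sum_eq_single p.o]
    · congr 1
      exact vertex_mul_ofPath k p.o p rfl
    · intro v _ hv
      exact vertex_mul_ofPath_of_ne k v p hv
    · simp

theorem pathMulBilin_one_right [Fintype V] (x : GraphPath G →₀ k) :
    pathMulBilin k x (∑ v, Finsupp.single ⟨v, v, .nil⟩ 1) = x := by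
  induction x using Finsupp.induction_linear with
  | zero => simp
  | add x y hx hy => rw [map_add, LinearMap.add_apply, hx, hy]
  | single p c =>
    rw [← mul_one c, ← smul_eq_mul, ← Finsupp.smul_single, map_smul, LinearMap.smul_apply,
      map_sum, Finset.sum_eq_single p.t]
    · congr 1
      exact ofPath_mul_vertex k p.t p rfl
    · intro v _ hv
      exact ofPath_mul_vertex_of_ne k v p hv.symm
    · simp

/-- If the vertex set is finite, the path algebra is unital, with `1 = ∑ v, [v]`. -/
noncomputable instance [Fintype V] : Ring (PathAlgebra k G) where
  one := ∑ v, vertex k v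
  one_mul := pathMulBilin_one_left k
  mul_one := pathMulBilin_one_right k

theorem one_eq_sum_vertex [Fintype V] : (1 : PathAlgebra k G) = ∑ v, vertex k v := rfl

theorem vertex_mul_edge (v w : V) : vertex k v * edge k v w = (edge k v w : PathAlgebra k G) := by
  unfold edge; split_ifs
  · exact vertex_mul_ofPath k _ _ rfl
  · simp

theorem edge_mul_vertex (v w : V) : edge k v w * vertex k w = (edge k v w : PathAlgebra k G) := by
  unfold edge; split_ifs
  · exact ofPath_mul_vertex k _ _ rfl
  · simp

theorem vertex_mul_self (v : V) : vertex k v * vertex k v = (vertex k v : PathAlgebra k G) :=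
  vertex_mul_ofPath k v ⟨v, v, .nil⟩ rfl

theorem vertex_mul_vertex_of_ne {v w : V} (h : v ≠ w) :
    vertex k v * vertex k w = (0 : PathAlgebra k G) :=
  vertex_mul_ofPath_of_ne k v ⟨w, w, .nil⟩ h

end PathAlgebra

/-! ### The polynomials attached to the entries of a Coxeter matrix -/


/-- An auxiliary multiple of the minimal polynomial of `4 cos² (π / m)`, for `m ≥ 3`. It is only used
to prove the Coxeter relations. -/
noncomputable def braidPoly (m : ℕ) : ℤ[X] :=
  if Even m then (Chebyshev.S ℤ ((m / 2 : ℕ) - 1)).comp (X - 2)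
  else (Chebyshev.S ℤ (m / 2 : ℕ) + Chebyshev.S ℤ ((m / 2 : ℕ) - 1)).comp (X - 2)

section
variable {E : Type*} [Ring E]

theorem chebyshev_even {g h : E} (h1 : g * h = 1) (h2 : h * g = 1) (n : ℕ) :
    aeval (g + h) (Chebyshev.S ℤ ((n : ℤ) - 1)) * (g - h) = g ^ n - h ^ n := by
  induction n using Nat.twoStepInduction with
  | zero => simp
  | one => simp
  | more n ih1 ih2 =>
    have e : ((n + 2 : ℕ) : ℤ) - 1 = ((n : ℤ) - 1) + 2 := by push_cast; ring
    have e2 : ((n + 1 : ℕ) : ℤ) - 1 = ((n : ℤ) - 1) + 1 := by push_cast; ring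
    rw [e2] at ih2
    rw [e, Chebyshev.S_add_two, map_sub, map_mul, aeval_X, sub_mul, ih1, mul_assoc, ih2]
    have a1 : h * g ^ (n + 1) = g ^ n := by rw [pow_succ', ← mul_assoc, h2, one_mul]
    have a2 : g * h ^ (n + 1) = h ^ n := by rw [pow_succ', ← mul_assoc, h1, one_mul]
    rw [mul_sub, add_mul, add_mul, a1, a2, ← pow_succ', ← pow_succ']
    abel

theorem chebyshev_odd {g h : E} (h1 : g * h = 1) (h2 : h * g = 1) (n : ℕ) :
    aeval (g + h) (Chebyshev.S ℤ (n : ℤ) + Chebyshev.S ℤ ((n : ℤ) - 1)) * (g - 1)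
      = g ^ (n + 1) - h ^ n := by
  induction n using Nat.twoStepInduction with
  | zero => simp
  | one =>
    simp only [Nat.cast_one, Chebyshev.S_one, sub_self, Chebyshev.S_zero, map_add, aeval_X,
      map_one, pow_one, mul_sub, mul_one, add_mul, one_mul, h2, pow_add]
    abel
  | more n ih1 ih2 =>
    have e : ((n + 2 : ℕ) : ℤ) - 1 = ((n : ℤ) - 1) + 2 := by push_cast; ring
    have e0 : ((n + 2 : ℕ) : ℤ) = (n : ℤ) + 2 := by push_cast; ring
    have e2 : ((n + 1 : ℕ) : ℤ) - 1 = ((n : ℤ) - 1) + 1 := by push_cast; ring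
    have e3 : ((n + 1 : ℕ) : ℤ) = (n : ℤ) + 1 := by push_cast; ring
    rw [e2, e3] at ih2
    have key : Chebyshev.S ℤ ((n : ℤ) + 2) + Chebyshev.S ℤ (((n : ℤ) - 1) + 2)
        = X * (Chebyshev.S ℤ ((n : ℤ) + 1) + Chebyshev.S ℤ (((n : ℤ) - 1) + 1))
          - (Chebyshev.S ℤ (n : ℤ) + Chebyshev.S ℤ ((n : ℤ) - 1)) := by
      rw [Chebyshev.S_add_two, Chebyshev.S_add_two]; ring
    rw [e, e0, key, map_sub, map_mul, aeval_X, sub_mul, ih1, mul_assoc, ih2]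
    have a1 : h * g ^ (n + 1 + 1) = g ^ (n + 1) := by
      rw [pow_succ' g (n + 1), ← mul_assoc, h2, one_mul]
    have a2 : g * h ^ (n + 1) = h ^ n := by rw [pow_succ', ← mul_assoc, h1, one_mul]
    rw [mul_sub, add_mul, add_mul, a1, a2, ← pow_succ', ← pow_succ']
    abel

theorem aeval_mul_of_semiconj {a b x : E} (h : a * x = x * b) (p : ℤ[X]) :
    aeval a p * x = x * aeval b p := by
  induction p using Polynomial.induction_on' with
  | add p q hp hq => simp [add_mul, mul_add, hp, hq]
  | monomial n c =>
    have : a ^ n * x = x * b ^ n := (SemiconjBy.pow_right (show SemiconjBy x b a from h.symm) n).eq.symm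
    simp only [aeval_monomial, mul_assoc, this]
    rw [← mul_assoc, ← mul_assoc]
    congr 1
    simpa using (Int.cast_commute c x).eq

theorem reflection_pow_eq_one {x y : E} {m : ℕ} (hx : x * x = 2 * x) (hy : y * y = 2 * y)
    (hxy : aeval (x * y) (braidPoly m) * x = 0) (hyx : aeval (y * x) (braidPoly m) * y = 0) :
    ((1 - x) * (1 - y)) ^ m = 1 := by
  set g := (1 - x) * (1 - y) with hg
  set h := (1 - y) * (1 - x) with hh
  have rx : (1 - x) * (1 - x) = 1 := by
    have : (1 - x) * (1 - x) = 1 - 2 * x + x * x := by noncomm_ring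
    rw [this, hx]; abel
  have ry : (1 - y) * (1 - y) = 1 := by
    have : (1 - y) * (1 - y) = 1 - 2 * y + y * y := by noncomm_ring
    rw [this, hy]; abel
  have h1 : g * h = 1 := by
    rw [hg, hh, mul_assoc, ← mul_assoc (1 - y), ry, one_mul, rx]
  have h2 : h * g = 1 := by
    rw [hg, hh, mul_assoc, ← mul_assoc (1 - x), rx, one_mul, ry]
  -- the element `g + h + 2` multiplies `x` like `x * y` does, and `y` like `y * x` does
  have hT : g + h + 2 = 4 - 2 * x - 2 * y + x * y + y * x := by
    have e4 : (4 : E) = 1 + 1 + 2 := by norm_num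
    rw [hg, hh, e4]; noncomm_ring
  have tx : (g + h + 2) * x = x * (y * x) := by
    have : (g + h + 2) * x = 2 * x + 2 * x - 2 * (x * x) - 2 * (y * x) + x * y * x + y * (x * x) := by
      rw [hT]; noncomm_ring
    rw [this, hx]; noncomm_ring
  have ty : (g + h + 2) * y = y * (x * y) := by
    have : (g + h + 2) * y = 2 * y + 2 * y - 2 * (y * y) - 2 * (x * y) + y * x * y + x * (y * y) := by
      rw [hT]; noncomm_ring
    rw [this, hy]; noncomm_ring
  set Q := aeval (g + h + 2) (braidPoly m) with hQ
  have qx : Q * x = 0 := by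
    rw [hQ, aeval_mul_of_semiconj tx, ← aeval_mul_of_semiconj (mul_assoc x y x), hxy]
  have qy : Q * y = 0 := by
    rw [hQ, aeval_mul_of_semiconj ty, ← aeval_mul_of_semiconj (mul_assoc y x y), hyx]
  have qg : Q * (g - 1) = 0 := by
    have : Q * (g - 1) = Q * x * y - Q * x - Q * y := by rw [hg]; noncomm_ring
    rw [this, qx, qy]; simp
  have hcomp : ∀ p : ℤ[X], aeval (g + h + 2) (p.comp (X - 2)) = aeval (g + h) p := by
    intro p
    rw [aeval_comp, map_sub, aeval_X, map_ofNat, add_sub_cancel_right]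
  rcases Nat.even_or_odd' m with ⟨k, rfl | rfl⟩
  · have e : braidPoly (2 * k) = (Chebyshev.S ℤ ((k : ℤ) - 1)).comp (X - 2) := by
      simp [braidPoly]
    have : Q * (g - h) = g ^ k - h ^ k := by
      rw [hQ, e, hcomp, chebyshev_even h1 h2]
    have q0 : Q * (g - h) = 0 := by
      have : Q * (g - h) = Q * (g - 1) * (1 + h) := by
        have : (g - 1) * (1 + h) = g - h := by
          rw [mul_add, mul_one, sub_mul, h1, one_mul]; abel
        rw [mul_assoc, this]
      rw [this, qg, zero_mul]
    have hk : g ^ k = h ^ k := by rw [q0] at this; exact (sub_eq_zero.mp this.symm)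
    rw [two_mul, pow_add]
    nth_rw 1 [hk]
    rw [← (show Commute h g from h2.trans h1.symm).mul_pow, h2, one_pow]
  · have e : braidPoly (2 * k + 1)
        = (Chebyshev.S ℤ (k : ℤ) + Chebyshev.S ℤ ((k : ℤ) - 1)).comp (X - 2) := by
      have : (2 * k + 1) / 2 = k := by omega
      simp [braidPoly, this]
    have hk : g ^ (k + 1) - h ^ k = 0 := by
      rw [← chebyshev_odd h1 h2, ← hcomp, ← e]; exact qg
    have hk : g ^ (k + 1) = h ^ k := sub_eq_zero.mp hk
    rw [show 2 * k + 1 = (k + 1) + k by ring, pow_add, hk,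
      ← (show Commute h g from h2.trans h1.symm).mul_pow, h2, one_pow]

end

theorem aeval_braidPoly_eq_zero {m k : ℕ} (hm : 3 ≤ m) (hk : 1 ≤ k) (hkm : 2 * k < m) :
    aeval (4 * Real.cos (k * Real.pi / m) ^ 2 : ℝ) (braidPoly m) = 0 := by
  have hm0 : (0 : ℝ) < m := by positivity
  set θ : ℝ := 2 * (k * Real.pi / m) with hθ
  have h4 : (4 * Real.cos (k * Real.pi / m) ^ 2 : ℝ) = 2 * Real.cos θ + 2 := by
    rw [hθ, Real.cos_two_mul]; ring
  have hcomp : ∀ p : ℤ[X], aeval (2 * Real.cos θ + 2 : ℝ) (p.comp (X - 2))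
      = aeval (2 * Real.cos θ : ℝ) p := by
    intro p; rw [aeval_comp, map_sub, aeval_X, map_ofNat, add_sub_cancel_right]
  have hS : ∀ n : ℤ, aeval (2 * Real.cos θ : ℝ) (Chebyshev.S ℤ n) * Real.sin θ
      = Real.sin ((n + 1) * θ) := by
    intro n
    rw [← Chebyshev.S_two_mul_real_cos, ← Chebyshev.map_S (algebraMap ℤ ℝ), eval_map_algebraMap]
  have hsin : Real.sin θ ≠ 0 := by
    apply ne_of_gt
    apply Real.sin_pos_of_pos_of_lt_pi
    · have : (0 : ℝ) < k := by exact_mod_cast hk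
      have := Real.pi_pos
      positivity
    · have h' : (2 * k : ℝ) < m := by exact_mod_cast hkm
      have : θ = (2 * k / m) * Real.pi := by rw [hθ]; ring
      rw [this]
      have : (2 * k / m : ℝ) < 1 := by rw [div_lt_one hm0]; exact h'
      nlinarith [Real.pi_pos]
  have hmθ : m * θ = 2 * k * Real.pi := by rw [hθ]; field_simp
  rw [h4]
  apply (mul_eq_zero_iff_right hsin).mp
  rcases Nat.even_or_odd' m with ⟨l, rfl | rfl⟩
  · have e : braidPoly (2 * l) = (Chebyshev.S ℤ ((l : ℤ) - 1)).comp (X - 2) := by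
      simp [braidPoly]
    rw [e, hcomp, hS]
    have : (((l : ℤ) - 1 : ℤ) + 1 : ℝ) * θ = k * Real.pi := by
      push_cast at hmθ ⊢; linarith
    rw [this, Real.sin_nat_mul_pi]
  · have e : braidPoly (2 * l + 1)
        = (Chebyshev.S ℤ (l : ℤ) + Chebyshev.S ℤ ((l : ℤ) - 1)).comp (X - 2) := by
      have : (2 * l + 1) / 2 = l := by omega
      simp [braidPoly, this]
    rw [e, hcomp, map_add, add_mul, hS, hS]
    have : (((l : ℤ) - 1 : ℤ) + 1 : ℝ) * θ = k * (2 * Real.pi) - ((l : ℤ) + 1) * θ := by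
      push_cast at hmθ ⊢; linarith
    rw [this, Real.sin_nat_mul_two_pi_sub]
    push_cast; ring

/-- The polynomial `C_m`, for `m ≥ 3`: the minimal polynomial of the algebraic
integer `4 cos² (π / m)`. -/
noncomputable def cosPoly (m : ℕ) : ℤ[X] := minpoly ℤ (4 * Real.cos (Real.pi / m) ^ 2 : ℝ)

theorem cosPoly_dvd_braidPoly {m : ℕ} (hm : 3 ≤ m) : cosPoly m ∣ braidPoly m := by
  apply minpoly.isIntegrallyClosed_dvd
  · have h := (Real.isIntegral_two_mul_cos_rat_mul_pi (1 / m : ℚ)).pow 2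
    have e : (4 * Real.cos (Real.pi / m) ^ 2 : ℝ)
        = (2 * Real.cos (((1 / m : ℚ) : ℝ) * Real.pi)) ^ 2 := by
      push_cast
      rw [mul_pow, show (1 / (m : ℝ)) * Real.pi = Real.pi / m by ring]; norm_num
    rw [e]; exact h
  · have := aeval_braidPoly_eq_zero (k := 1) hm le_rfl (by omega)
    simpa using this

/-! ### The Coxeter graph -/

section Coxeter

variable {S : Type*}

/-- The Coxeter graph: `r` and `s` are joined by an edge if `m_{r,s} ≥ 3` or `m_{r,s} = ∞`
(an infinite entry of a `CoxeterMatrix` is written `0`). -/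
def coxeterGraph (M : CoxeterMatrix S) : SimpleGraph S where
  Adj r s := r ≠ s ∧ M r s ≠ 2
  symm := ⟨fun r s h => ⟨h.1.symm, by rw [M.symmetric]; exact h.2⟩⟩
  loopless := ⟨fun _ h => h.1 rfl⟩

/-! ### Real reflection matrices and Cartan matrices -/

/-- `A` is a strict real reflection matrix for the Coxeter matrix `M`. No condition is imposed on
`a_{r,s}` if `m_{r,s} = ∞`. -/
structure IsStrictReflectionMatrix (M : CoxeterMatrix S) (A : Matrix S S ℝ) : Prop where
  diag : ∀ s, A s s = 2
  eq_zero : ∀ r s, M r s = 2 → A r s = 0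
  mul_eq : ∀ r s, 3 ≤ M r s → ∃ k : ℕ, 1 ≤ k ∧ 2 * k ≤ M r s ∧ k.Coprime (M r s) ∧
    A r s * A s r = 4 * Real.cos (k * Real.pi / M r s) ^ 2

/-- `A` is a (possibly non-crystallographic) generalized Cartan matrix for the Coxeter
matrix `M`; the last condition concerns the pairs with `m_{r,s} = ∞`. -/
structure IsNGCM (M : CoxeterMatrix S) (A : Matrix S S ℝ) : Prop where
  diag : ∀ s, A s s = 2
  nonpos : ∀ r s, r ≠ s → A r s ≤ 0
  eq_zero : ∀ r s, M r s = 2 → A r s = 0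
  mul_eq : ∀ r s, 3 ≤ M r s → A r s * A s r = 4 * Real.cos (Real.pi / M r s) ^ 2
  four_le : ∀ r s, M r s = 0 → 4 ≤ A r s * A s r

theorem IsNGCM.isStrictReflectionMatrix {M : CoxeterMatrix S} {A : Matrix S S ℝ} (hA : IsNGCM M A) :
    IsStrictReflectionMatrix M A where
  diag := hA.diag
  eq_zero := hA.eq_zero
  mul_eq r s h := ⟨1, le_rfl, by omega, by simp, by simpa using hA.mul_eq r s h⟩

/-- `A` is a Cartan matrix for the Coxeter matrix `M`: an integral generalized Cartan matrix. -/
def IsCartanMatrix (M : CoxeterMatrix S) (A : Matrix S S ℤ) : Prop :=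
  IsNGCM M (A.map (Int.cast : ℤ → ℝ))

/-! ### The Coxeter relations -/

/-- The involutions `1 - x s` satisfy the Coxeter relations. -/
theorem isLiftable_of_relations (M : CoxeterMatrix S) {E : Type*} [Ring E] (x : S → E)
    (h1 : ∀ s, x s * x s = 2 * x s) (h2 : ∀ r s, M r s = 2 → x r * x s = 0)
    (h3 : ∀ r s, 3 ≤ M r s → aeval (x r * x s) (braidPoly (M r s)) * x r = 0) :
    M.IsLiftable fun s => 1 - x s := by
  intro r s
  dsimp only
  by_cases hrs : r = s
  · subst hrs
    rw [M.diagonal, pow_one, show (1 - x r) * (1 - x r) = 1 - 2 * x r + x r * x r by noncomm_ring,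
      h1]
    abel
  have hne := M.off_diagonal r s hrs
  rcases Nat.lt_or_ge (M r s) 3 with h | h
  · have : M r s = 0 ∨ M r s = 2 := by omega
    rcases this with h0 | h0
    · rw [h0, pow_zero]
    · have a := h2 r s h0
      have b := h2 s r (by rw [M.symmetric, h0])
      have e : ((1 - x r) * (1 - x s)) = 1 - x r - x s := by
        rw [show (1 - x r) * (1 - x s) = 1 - x r - x s + x r * x s by noncomm_ring, a, add_zero]
      rw [h0, e, pow_two, show (1 - x r - x s) * (1 - x r - x s)
        = 1 - 2 * x r - 2 * x s + x r * x r + x s * x s + x r * x s + x s * x r by noncomm_ring,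
        h1, h1, a, b]
      abel
  · refine reflection_pow_eq_one (h1 r) (h1 s) (h3 r s h) ?_
    have h' : 3 ≤ M s r := by rw [M.symmetric]; exact h
    have := h3 s r h'
    rwa [M.symmetric] at this

theorem ne_of_ne_one (M : CoxeterMatrix S) {r s : S} (h : M r s ≠ 1) : r ≠ s := by
  rintro rfl; exact h (M.diagonal r)

/-! ### The ring `R_{W,S}` and its commuting left and right actions of `W` -/

variable [Fintype S]

/-- The path algebra over `ℤ` of the Coxeter graph. -/
abbrev CoxeterPathAlgebra (M : CoxeterMatrix S) : Type _ := PathAlgebra ℤ (coxeterGraph M)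

/-- The generators `C_m([r s r])`, for `3 ≤ m = m_{r,s} < ∞`, of the ideal `I_{W,S}`. The polynomial
`C_m` is evaluated at `[r s][s r]` in the ring `[r] P [r]`, whose identity element is `[r]`; this
is `[r]` times its value in the unital ring `P`. -/
def strictRelations (M : CoxeterMatrix S) : Set (CoxeterPathAlgebra M) :=
  {x | ∃ r s : S, 3 ≤ M r s ∧
    x = vertex ℤ r * aeval (edge ℤ r s * edge ℤ s r : CoxeterPathAlgebra M) (cosPoly (M r s))}

/-- The ring `R_{W,S}`: the quotient of the path algebra by the two-sided ideal `I_{W,S}`. -/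
def StrictRing (M : CoxeterMatrix S) : Type _ :=
  (TwoSidedIdeal.span (strictRelations M)).ringCon.Quotient

noncomputable instance (M : CoxeterMatrix S) : Ring (StrictRing M) :=
  inferInstanceAs (Ring (TwoSidedIdeal.span (strictRelations M)).ringCon.Quotient)

/-- The canonical surjection from the path algebra to `R_{W,S}`. -/
noncomputable def toStrictRing (M : CoxeterMatrix S) : CoxeterPathAlgebra M →+* StrictRing M :=
  (TwoSidedIdeal.span (strictRelations M)).ringCon.mk'

/-- The image of `[s]` in `R_{W,S}`. -/
noncomputable def vertexR (M : CoxeterMatrix S) (s : S) : StrictRing M :=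
  toStrictRing M (vertex ℤ s)

/-- The image of `[r s]` in `R_{W,S}`; it is `0` if `m_{r,s} ≤ 2`. -/
noncomputable def edgeR (M : CoxeterMatrix S) (r s : S) : StrictRing M :=
  toStrictRing M (edge ℤ r s)

variable (M : CoxeterMatrix S)

theorem one_eq_sum_vertexR : (1 : StrictRing M) = ∑ s, vertexR M s := by
  rw [← map_one (toStrictRing M), one_eq_sum_vertex, map_sum]; rfl

theorem vertexR_mul_self (s : S) : vertexR M s * vertexR M s = vertexR M s := by
  rw [vertexR, ← map_mul, vertex_mul_self]

theorem vertexR_mul_of_ne {r s : S} (h : r ≠ s) : vertexR M r * vertexR M s = 0 := by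
  rw [vertexR, vertexR, ← map_mul, vertex_mul_vertex_of_ne ℤ h, map_zero]

theorem vertexR_mul_edgeR (r s : S) : vertexR M r * edgeR M r s = edgeR M r s := by
  rw [vertexR, edgeR, ← map_mul, vertex_mul_edge]

theorem edgeR_mul_vertexR (r s : S) : edgeR M r s * vertexR M s = edgeR M r s := by
  rw [vertexR, edgeR, ← map_mul, edge_mul_vertex]

theorem edgeR_mul_vertexR_of_ne {r s t : S} (h : s ≠ t) : edgeR M r s * vertexR M t = 0 := by
  rw [← edgeR_mul_vertexR, mul_assoc, vertexR_mul_of_ne M h, mul_zero]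

theorem vertexR_mul_edgeR_of_ne {r s t : S} (h : t ≠ r) : vertexR M t * edgeR M r s = 0 := by
  rw [← vertexR_mul_edgeR, ← mul_assoc, vertexR_mul_of_ne M h, zero_mul]

theorem edgeR_self (s : S) : edgeR M s s = 0 := by
  rw [edgeR, edge, dif_neg (by simp), map_zero]

theorem edgeR_eq_zero {r s : S} (h : M r s = 2) : edgeR M r s = 0 := by
  rw [edgeR, edge, dif_neg (by simp [coxeterGraph, h]), map_zero]

theorem vertexR_mul_aeval_braidPoly {r s : S} (h : 3 ≤ M r s) :
    vertexR M r * aeval (edgeR M r s * edgeR M s r) (braidPoly (M r s)) = 0 := by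
  have h1 : vertexR M r * aeval (edgeR M r s * edgeR M s r) (cosPoly (M r s)) = 0 := by
    have h2 : toStrictRing M (vertex ℤ r * aeval (edge ℤ r s * edge ℤ s r : CoxeterPathAlgebra M)
        (cosPoly (M r s))) = 0 := by
      have : vertex ℤ r * aeval (edge ℤ r s * edge ℤ s r : CoxeterPathAlgebra M) (cosPoly (M r s))
          ∈ TwoSidedIdeal.span (strictRelations M) := TwoSidedIdeal.subset_span ⟨r, s, h, rfl⟩
      rw [TwoSidedIdeal.mem_iff] at this
      exact (RingCon.eq _).mpr this
    have h3 := aeval_algHom_apply (toStrictRing M).toIntAlgHom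
      (edge ℤ r s * edge ℤ s r : CoxeterPathAlgebra M) (cosPoly (M r s))
    change aeval (toStrictRing M _) _ = toStrictRing M _ at h3
    rw [map_mul, ← h3, map_mul] at h2
    exact h2
  obtain ⟨q, hq⟩ := cosPoly_dvd_braidPoly h
  rw [hq, map_mul, ← mul_assoc, h1, zero_mul]

variable [DecidableEq S]

/-- `1 - s · 1`, for the left action of the simple reflection `s` on `R_{W,S}`. -/
noncomputable def leftRoot (s : S) : StrictRing M :=
  2 * vertexR M s - ∑ r ∈ Finset.univ.erase s, edgeR M s r

/-- `1 - 1 · s`, for the right action of the simple reflection `s` on `R_{W,S}`. -/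
noncomputable def rightRoot (s : S) : StrictRing M :=
  2 * vertexR M s - ∑ r ∈ Finset.univ.erase s, edgeR M r s

theorem mul_two_mul {E : Type*} [Ring E] (a b : E) : a * (2 * b) = 2 * (a * b) := by
  noncomm_ring

theorem vertexR_mul_leftRoot (s : S) : vertexR M s * leftRoot M s = leftRoot M s := by
  rw [leftRoot, mul_sub, mul_two_mul, vertexR_mul_self, Finset.mul_sum]
  simp only [vertexR_mul_edgeR]

theorem rightRoot_mul_vertexR (s : S) : rightRoot M s * vertexR M s = rightRoot M s := by
  rw [rightRoot, sub_mul, mul_assoc, vertexR_mul_self, Finset.sum_mul]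
  simp only [edgeR_mul_vertexR]

theorem leftRoot_mul_vertexR_self (s : S) : leftRoot M s * vertexR M s = 2 * vertexR M s := by
  rw [leftRoot, sub_mul, mul_assoc, vertexR_mul_self, Finset.sum_mul, Finset.sum_eq_zero, sub_zero]
  intro r hr
  exact edgeR_mul_vertexR_of_ne M (Finset.ne_of_mem_erase hr)

theorem vertexR_mul_rightRoot_self (s : S) : vertexR M s * rightRoot M s = 2 * vertexR M s := by
  rw [rightRoot, mul_sub, mul_two_mul, vertexR_mul_self, Finset.mul_sum, Finset.sum_eq_zero,
    sub_zero]
  intro r hr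
  exact vertexR_mul_edgeR_of_ne M (Finset.ne_of_mem_erase hr).symm

theorem leftRoot_mul_vertexR {r s : S} (h : s ≠ r) : leftRoot M s * vertexR M r = -edgeR M s r := by
  rw [leftRoot, sub_mul, mul_assoc, vertexR_mul_of_ne M h, Finset.sum_mul,
    Finset.sum_eq_single r]
  · rw [edgeR_mul_vertexR]; simp
  · intro t _ ht
    exact edgeR_mul_vertexR_of_ne M ht
  · intro hr
    exact absurd (Finset.mem_erase.mpr ⟨h.symm, Finset.mem_univ r⟩) hr

theorem vertexR_mul_rightRoot {r s : S} (h : s ≠ r) :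
    vertexR M r * rightRoot M s = -edgeR M r s := by
  rw [rightRoot, mul_sub, mul_two_mul, vertexR_mul_of_ne M h.symm, Finset.mul_sum,
    Finset.sum_eq_single r]
  · rw [vertexR_mul_edgeR]; simp
  · intro t _ ht
    exact vertexR_mul_edgeR_of_ne M ht.symm
  · intro hr
    exact absurd (Finset.mem_erase.mpr ⟨h.symm, Finset.mem_univ r⟩) hr

theorem leftRoot_mul_leftRoot {r s : S} (h : r ≠ s) :
    leftRoot M r * leftRoot M s = -edgeR M r s * leftRoot M s := by
  conv_lhs => rw [← vertexR_mul_leftRoot M s, ← mul_assoc, leftRoot_mul_vertexR M h]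

theorem rightRoot_mul_rightRoot {r s : S} (h : r ≠ s) :
    rightRoot M r * rightRoot M s = -(rightRoot M r * edgeR M r s) := by
  conv_lhs => rw [← rightRoot_mul_vertexR M r, mul_assoc, vertexR_mul_rightRoot M h.symm, mul_neg]

theorem isLiftable_left : M.IsLiftable fun s => 1 - leftRoot M s := by
  apply isLiftable_of_relations M
  · intro s
    nth_rw 2 [← vertexR_mul_leftRoot M s]
    rw [← mul_assoc, leftRoot_mul_vertexR_self, mul_assoc, vertexR_mul_leftRoot]
  · intro r s h
    rw [leftRoot_mul_leftRoot M (ne_of_ne_one M (by omega)), edgeR_eq_zero M h]; simp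
  · intro r s h
    have hrs : r ≠ s := ne_of_ne_one M (by omega)
    have e : edgeR M r s * edgeR M s r * leftRoot M r
        = leftRoot M r * (leftRoot M s * leftRoot M r) := by
      rw [leftRoot_mul_leftRoot M hrs.symm, ← mul_assoc, mul_neg]
      conv_rhs => rw [← vertexR_mul_edgeR M s r, ← mul_assoc, leftRoot_mul_vertexR M hrs]
      noncomm_ring
    rw [aeval_mul_of_semiconj (mul_assoc _ _ _), ← aeval_mul_of_semiconj e,
      ← vertexR_mul_leftRoot M r, ← mul_assoc]
    have c : (edgeR M r s * edgeR M s r) * vertexR M r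
        = vertexR M r * (edgeR M r s * edgeR M s r) := by
      rw [mul_assoc, edgeR_mul_vertexR, ← mul_assoc, vertexR_mul_edgeR]
    rw [aeval_mul_of_semiconj c, vertexR_mul_aeval_braidPoly M h, zero_mul]

theorem isLiftable_right : M.IsLiftable fun s => 1 - rightRoot M s := by
  apply isLiftable_of_relations M
  · intro s
    conv_lhs => rw [← rightRoot_mul_vertexR M s]
    rw [mul_assoc, rightRoot_mul_vertexR, vertexR_mul_rightRoot_self, mul_two_mul,
      rightRoot_mul_vertexR]
  · intro r s h
    rw [rightRoot_mul_rightRoot M (ne_of_ne_one M (by omega)), edgeR_eq_zero M h]; simp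
  · intro r s h
    have hrs : r ≠ s := ne_of_ne_one M (by omega)
    have e : rightRoot M r * rightRoot M s * rightRoot M r
        = rightRoot M r * (edgeR M r s * edgeR M s r) := by
      rw [rightRoot_mul_rightRoot M hrs, neg_mul, mul_assoc]
      conv_lhs => rw [← edgeR_mul_vertexR M r s, mul_assoc, vertexR_mul_rightRoot M hrs]
      noncomm_ring
    rw [aeval_mul_of_semiconj e, ← rightRoot_mul_vertexR M r, mul_assoc,
      vertexR_mul_aeval_braidPoly M h, mul_zero]

variable {M} {W : Type*} [Group W] (cs : CoxeterSystem M W)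

/-- The element `w · 1` of `R_{W,S}`; for a simple reflection `s`, it is `1 - 2 [s] + ∑ [s r]`,
where the sum is over `r ≠ s`. -/
noncomputable def leftElt : W →* StrictRing M := cs.lift ⟨_, isLiftable_left M⟩

/-- The element `1 · w` of `R_{W,S}`; for a simple reflection `s`, it is `1 - 2 [s] + ∑ [r s]`,
where the sum is over `r ≠ s`. -/
noncomputable def rightElt : W →* StrictRing M := cs.lift ⟨_, isLiftable_right M⟩

/-- The commuting left and right actions of `W` on `R_{W,S}`, as an action of `W × W^op`: the left
action is right `R_{W,S}`-linear and the right action is left `R_{W,S}`-linear. They are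
characterized on the elements `[r]` by `leftElt_simple_mul` and `mul_rightElt_simple`. -/
noncomputable def biactionR : Representation ℤ (W × Wᵐᵒᵖ) (StrictRing M) where
  toFun g := LinearMap.mulLeft ℤ (leftElt cs g.1) ∘ₗ LinearMap.mulRight ℤ (rightElt cs g.2.unop)
  map_one' := by ext x; simp
  map_mul' g h := by ext x; simp [mul_assoc]

theorem biactionR_apply (w w' : W) (x : StrictRing M) :
    biactionR cs (w, .op w') x = leftElt cs w * (x * rightElt cs w') := rfl

theorem leftElt_simple_mul (s r : S) : leftElt cs (cs.simple s) * vertexR M r =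
    if r = s then -vertexR M s else vertexR M r + edgeR M s r := by
  rw [leftElt, CoxeterSystem.lift_apply_simple, sub_mul, one_mul]
  split_ifs with h
  · subst h; rw [leftRoot_mul_vertexR_self]; noncomm_ring
  · rw [leftRoot_mul_vertexR M (Ne.symm h)]; noncomm_ring

theorem mul_rightElt_simple (s r : S) : vertexR M r * rightElt cs (cs.simple s) =
    if r = s then -vertexR M s else vertexR M r + edgeR M r s := by
  rw [rightElt, CoxeterSystem.lift_apply_simple, mul_sub, mul_one]
  split_ifs with h
  · subst h; rw [vertexR_mul_rightRoot_self]; noncomm_ring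
  · rw [vertexR_mul_rightRoot M (Ne.symm h)]; noncomm_ring

/-- The `ℝ`-algebra `R' = R_{W,S} ⊗_ℤ ℝ`. -/
abbrev RealStrictRing (M : CoxeterMatrix S) : Type _ := ℝ ⊗[ℤ] StrictRing M

/-- The action of `W × W^op` on `R'` obtained by base change. -/
noncomputable def biactionR' : Representation ℝ (W × Wᵐᵒᵖ) (RealStrictRing M) where
  toFun g := (biactionR cs g).baseChange ℝ
  map_one' := by rw [map_one]; exact LinearMap.baseChange_id
  map_mul' g h := by rw [map_mul]; exact LinearMap.baseChange_comp _ _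

/-! ### The standard reflection representations -/

/-- The real vector space `V_A` with basis the simple roots. -/
abbrev RootSpace (S : Type*) : Type _ := S → ℝ

/-- The real vector space `V̌_A` with basis the simple coroots. -/
abbrev CorootSpace (S : Type*) : Type _ := S → ℝ

/-- The simple root `α_s`. -/
def simpleRoot (s : S) : RootSpace S := Pi.single s 1

/-- The simple coroot `α̌_s`. -/
def simpleCoroot (s : S) : CorootSpace S := Pi.single s 1

/-- The pairing of `V_A` and `V̌_A`, with `⟨α_r, α̌_s⟩ = a_{r,s}`. -/
noncomputable def pairing (A : Matrix S S ℝ) : RootSpace S →ₗ[ℝ] CorootSpace S →ₗ[ℝ] ℝ :=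
  Matrix.toLinearMap₂' ℝ A

/-- The map `v ↦ ⟨v, α̌_s⟩ α_s`. -/
noncomputable def rootMap (A : Matrix S S ℝ) (s : S) : Module.End ℝ (RootSpace S) :=
  ((pairing A).flip (simpleCoroot s)).smulRight (simpleRoot s)

/-- The map `v ↦ ⟨α_s, v⟩ α̌_s`. -/
noncomputable def corootMap (A : Matrix S S ℝ) (s : S) : Module.End ℝ (CorootSpace S) :=
  (pairing A (simpleRoot s)).smulRight (simpleCoroot s)

theorem pairing_simple (A : Matrix S S ℝ) (r s : S) :
    pairing A (simpleRoot r) (simpleCoroot s) = A r s := by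
  simp [pairing, simpleRoot, simpleCoroot, Matrix.toLinearMap₂'_apply']

theorem isLiftable_of_rankOne {A : Matrix S S ℝ} (hA : IsStrictReflectionMatrix M A)
    (x : S → Module.End ℝ (S → ℝ)) (f : S → (S → ℝ) →ₗ[ℝ] ℝ) (v : S → S → ℝ)
    (hx : ∀ s, x s = (f s).smulRight (v s))
    (hf : (∀ r s, f r (v s) = A s r) ∨ (∀ r s, f r (v s) = A r s)) :
    M.IsLiftable fun s => 1 - x s := by
  have hd : ∀ s, f s (v s) = 2 := by
    intro s; rcases hf with hf | hf <;> rw [hf, hA.diag]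
  have hz : ∀ r s, M r s = 2 → f r (v s) = 0 := by
    intro r s h
    rcases hf with hf | hf
    · rw [hf]; exact hA.eq_zero s r (by rw [M.symmetric, h])
    · rw [hf]; exact hA.eq_zero r s h
  have hm : ∀ r s, f r (v s) * f s (v r) = A r s * A s r := by
    intro r s; rcases hf with hf | hf <;> rw [hf, hf]
    exact mul_comm _ _
  apply isLiftable_of_relations M
  · intro s
    refine LinearMap.ext fun y => ?_
    simp [hx, hd, two_mul, two_smul]
  · intro r s h
    refine LinearMap.ext fun y => ?_
    simp [hx, hz r s h]
  · intro r s h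
    have e : x r * (x s * x r) = algebraMap ℝ _ (A r s * A s r) * x r := by
      rw [← hm]
      refine LinearMap.ext fun y => ?_
      simp only [hx, Module.End.mul_apply, LinearMap.smulRight_apply, map_smul,
        Module.algebraMap_end_apply, smul_smul]
      congr 1; ring
    obtain ⟨k, hk1, hk2, hk3, hk⟩ := hA.mul_eq r s h
    have hlt : 2 * k < M r s := by
      rcases hk2.lt_or_eq with h' | h'
      · exact h'
      · exfalso
        rw [← h'] at hk3
        have := (Nat.coprime_self k).mp (Nat.Coprime.coprime_mul_left_right hk3)
        omega
    rw [aeval_mul_of_semiconj (mul_assoc _ _ _), ← aeval_mul_of_semiconj e.symm,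
      aeval_algebraMap_apply, hk, aeval_braidPoly_eq_zero h hk1 hlt]
    simp

/-- The standard reflection representation of `W` on `V_A`, in which a simple reflection `s` acts
by `v ↦ v - ⟨v, α̌_s⟩ α_s`. -/
noncomputable def rootRep {A : Matrix S S ℝ} (hA : IsStrictReflectionMatrix M A) :
    Representation ℝ W (RootSpace S) :=
  cs.lift ⟨fun s => 1 - rootMap A s, isLiftable_of_rankOne hA _ _ _ (fun _ => rfl)
    (.inl fun r s => pairing_simple A s r)⟩

/-- The standard reflection representation of `W` on `V̌_A`, in which a simple reflection `s` acts
by `v ↦ v - ⟨α_s, v⟩ α̌_s`. -/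
noncomputable def corootRep {A : Matrix S S ℝ} (hA : IsStrictReflectionMatrix M A) :
    Representation ℝ W (CorootSpace S) :=
  cs.lift ⟨fun s => 1 - corootMap A s, isLiftable_of_rankOne hA _ _ _ (fun _ => rfl)
    (.inr fun r s => pairing_simple A r s)⟩

theorem rootRep_simple {A : Matrix S S ℝ} (hA : IsStrictReflectionMatrix M A) (s r : S) :
    rootRep cs hA (cs.simple s) (simpleRoot r) = simpleRoot r - A r s • simpleRoot s := by
  rw [rootRep, CoxeterSystem.lift_apply_simple, LinearMap.sub_apply, ← pairing_simple A r s]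
  rfl

theorem corootRep_simple {A : Matrix S S ℝ} (hA : IsStrictReflectionMatrix M A) (s r : S) :
    corootRep cs hA (cs.simple s) (simpleCoroot r)
      = simpleCoroot r - A s r • simpleCoroot s := by
  rw [corootRep, CoxeterSystem.lift_apply_simple, LinearMap.sub_apply, ← pairing_simple A s r]
  rfl

/-- The action of `W × W^op` on `V̌_A ⊗ V_A`: here `W` acts on the left of `V̌_A`, and on the right
of `V_A` by `v w = w⁻¹ v`. -/
noncomputable def biactionTensor {A : Matrix S S ℝ} (hA : IsStrictReflectionMatrix M A) :
    Representation ℝ (W × Wᵐᵒᵖ) (CorootSpace S ⊗[ℝ] RootSpace S) where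
  toFun g := TensorProduct.map (corootRep cs hA g.1) (rootRep cs hA g.2.unop⁻¹)
  map_one' := by simp
  map_mul' g h := by simp [TensorProduct.map_mul]

/-- The action of `W × W^op` on `Mat_{S×S}(ℝ)`: the matrix of the left action of `w` on `V̌_A`
multiplies from the left, and the matrix of the right action of `w'` on (row vectors in) `V_A`
multiplies from the right. Thus the left action is right linear, the right action is left linear. -/
noncomputable def biactionMatrix {A : Matrix S S ℝ} (hA : IsStrictReflectionMatrix M A) :
    Representation ℝ (W × Wᵐᵒᵖ) (Matrix S S ℝ) where
  toFun g := LinearMap.mulLeft ℝ (LinearMap.toMatrix' (corootRep cs hA g.1)) ∘ₗ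
    LinearMap.mulRight ℝ (LinearMap.toMatrix' (rootRep cs hA g.2.unop⁻¹)).transpose
  map_one' := by ext1 x; simp
  map_mul' g h := by ext1 x; simp [mul_assoc, LinearMap.toMatrix'_mul]

end Coxeter

end StrictReflection

open StrictReflection

/-! For `m` equal to 3, 4 or 6 the number `4 cos² (π / m)` is an integer `c`, namely 1, 2 or 3, so
`C_m = X - c` and the defining relation of `R_{W,S}` reads `[r s r] = c [r]`. A strict real
reflection matrix satisfies `a_{r,s} a_{s,r} = c` for the same `c`. Hence `[s] ↦ e_{s,s}`, `[r s] ↦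
-a_{r,s} e_{r,s}` defines a ring homomorphism from `R_{W,S}` to the matrices (`strictRingHom`). The
sign makes `s [r] = [r] + [s r]` match `s α̌_r = α̌_r - a_{s,r} α̌_s`.

If the graph is a tree, the relation removes every backtrack at the cost of an integer factor, so
`R'` is spanned by the classes of the unique paths from `r` to `s`, one for each pair
(`exists_walkClass_eq_smul_of_isPath`). Their images are nonzero multiples of the matrix units
`e_{r,s}`, so the homomorphism becomes bijective over `ℝ` (`realStrictRingHom_bijective`).

On both sides the group acts by multiplication with fixed elements on the left and on the right, so
equivariance only needs these elements to correspond. As they depend multiplicatively on `w`, simple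
reflections suffice (`strictRingHom_leftElt`, `strictRingHom_rightElt`).

The finite Weyl case reduces to the tree case. Averaging over `W` gives an invariant inner product
on `V_A`. By Cauchy–Schwarz, `a_{r,s} a_{s,r} < 4` for `r ≠ s`, and integrality leaves only
`m_{r,s}` in `{2, 3, 4, 6}`. Positivity at the sum of the normalized simple roots gives fewer edges
than vertices (`card_edgeSet_lt_card`), so the connected graph is a tree. -/

namespace StrictReflection

/-! ### The homomorphism from the path algebra to the matrix ring -/

section MatrixModel

variable {S : Type*}

/-- The product of the numbers `-a_{u,v}` over the steps of a walk. -/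
noncomputable def walkWeight (A : Matrix S S ℝ) {G : SimpleGraph S} :
    ∀ {u v : S}, G.Walk u v → ℝ
  | _, _, .nil => 1
  | u, _, .cons (v := v) _ p => -A u v * walkWeight A p

theorem walkWeight_append (A : Matrix S S ℝ) {G : SimpleGraph S} {u v w : S} (p : G.Walk u v)
    (q : G.Walk v w) : walkWeight A (p.append q) = walkWeight A p * walkWeight A q := by
  induction p with
  | nil => simp [walkWeight]
  | cons h p ih => simp [walkWeight, ih, mul_assoc]

theorem walkWeight_ne_zero {A : Matrix S S ℝ} {G : SimpleGraph S}
    (hA : ∀ u v, G.Adj u v → A u v ≠ 0) {u v : S} (p : G.Walk u v) : walkWeight A p ≠ 0 := by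
  induction p with
  | nil => simp [walkWeight]
  | cons h p ih => exact mul_ne_zero (neg_ne_zero.mpr (hA _ _ h)) ih

variable [Fintype S] [DecidableEq S]

/-- The matrix `walkWeight A p • e_{o,t}` attached to a path `p` from `o` to `t`. -/
noncomputable def pathMatrix (A : Matrix S S ℝ) {G : SimpleGraph S} (p : GraphPath G) :
    Matrix S S ℝ := Matrix.single p.o p.t (walkWeight A p.walk)

/-- The linear extension of `pathMatrix` to the path algebra. -/
noncomputable def pathMatrixLinear (A : Matrix S S ℝ) (G : SimpleGraph S) :
    (GraphPath G →₀ ℤ) →ₗ[ℤ] Matrix S S ℝ := Finsupp.lift _ ℤ _ (pathMatrix A)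

/-- Matrix units compose exactly when the paths do, and the weights multiply along a concatenation.
-/
theorem pathMatrixLinear_pathMulBilin (A : Matrix S S ℝ) (G : SimpleGraph S)
    (x y : GraphPath G →₀ ℤ) :
    pathMatrixLinear A G (pathMulBilin ℤ x y) = pathMatrixLinear A G x * pathMatrixLinear A G y := by
  have key : ∀ p q : GraphPath G,
      pathMatrixLinear A G (pathMul ℤ p q) = pathMatrix A p * pathMatrix A q := by
    rintro ⟨a, b, p⟩ ⟨c, d, q⟩
    by_cases h : b = c
    · subst h
      simp [pathMul, pathMatrixLinear, pathMatrix, walkWeight_append]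
    · simp [pathMul, pathMatrixLinear, pathMatrix, h]
  induction x using Finsupp.induction_linear with
  | zero => simp
  | add x x' hx hx' => simp only [map_add, LinearMap.add_apply, hx, hx', add_mul]
  | single p a =>
    induction y using Finsupp.induction_linear with
    | zero => simp
    | add y y' hy hy' => simp only [map_add, hy, hy', mul_add]
    | single q b =>
      rw [← mul_one a, ← mul_one b, ← smul_eq_mul, ← smul_eq_mul, ← Finsupp.smul_single,
        ← Finsupp.smul_single]
      simp only [map_smul, LinearMap.smul_apply, pathMulBilin_single, key, smul_mul_assoc,
        mul_smul_comm]
      simp [pathMatrixLinear]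

/-- The ring homomorphism from the path algebra to the matrix ring that maps `[s]` to `e_{s,s}` and
`[r s]` to `-a_{r,s} e_{r,s}`. -/
noncomputable def pathMatrixHom (A : Matrix S S ℝ) (G : SimpleGraph S) :
    PathAlgebra ℤ G →+* Matrix S S ℝ where
  toFun := pathMatrixLinear A G
  map_one' := by
    change pathMatrixLinear A G (∑ v, Finsupp.single ⟨v, v, .nil⟩ 1) = 1
    ext i j
    simp [pathMatrixLinear, pathMatrix, walkWeight, Matrix.sum_apply, Matrix.single_apply,
      Matrix.one_apply, ite_and]
  map_mul' := pathMatrixLinear_pathMulBilin A G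
  map_zero' := map_zero (pathMatrixLinear A G)
  map_add' := map_add (pathMatrixLinear A G)

theorem pathMatrixHom_ofPath (A : Matrix S S ℝ) {G : SimpleGraph S} (p : GraphPath G) :
    pathMatrixHom A G (ofPath ℤ p) = pathMatrix A p := by
  change pathMatrixLinear A G (Finsupp.single p 1) = _
  simp [pathMatrixLinear]

theorem pathMatrixHom_vertex (A : Matrix S S ℝ) (G : SimpleGraph S) (s : S) :
    pathMatrixHom A G (vertex ℤ s) = Matrix.single s s 1 :=
  pathMatrixHom_ofPath A _

theorem pathMatrixHom_edge (A : Matrix S S ℝ) (G : SimpleGraph S) {r s : S}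
    (h : ¬ G.Adj r s → A r s = 0) :
    pathMatrixHom A G (edge ℤ r s) = Matrix.single r s (-A r s) := by
  unfold edge
  split_ifs with hrs
  · rw [pathMatrixHom_ofPath]
    simp [pathMatrix, walkWeight]
  · simp [h hrs]

end MatrixModel

section

/-! ### Crystallographic entries -/

theorem cosPoly_three : cosPoly 3 = X - C 1 := by
  rw [cosPoly, Nat.cast_ofNat, Real.cos_pi_div_three, ← minpoly.eq_X_sub_C_of_algebraMap_inj
    (B := ℝ) (1 : ℤ) (algebraMap ℤ ℝ).injective_int]
  norm_num

theorem cosPoly_four : cosPoly 4 = X - C 2 := by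
  rw [cosPoly, Nat.cast_ofNat, Real.cos_pi_div_four, ← minpoly.eq_X_sub_C_of_algebraMap_inj
    (B := ℝ) (2 : ℤ) (algebraMap ℤ ℝ).injective_int, div_pow, Real.sq_sqrt (by norm_num)]
  norm_num

theorem cosPoly_six : cosPoly 6 = X - C 3 := by
  rw [cosPoly, Nat.cast_ofNat, Real.cos_pi_div_six, ← minpoly.eq_X_sub_C_of_algebraMap_inj
    (B := ℝ) (3 : ℤ) (algebraMap ℤ ℝ).injective_int, div_pow, Real.sq_sqrt (by norm_num)]
  norm_num

variable {S : Type*} {M : CoxeterMatrix S} {A : Matrix S S ℝ}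

/-- For `m_{r,s} ∈ {3, 4, 6}`, the polynomial `C_m` is linear, and `a_{r,s} a_{s,r}` is its root. -/
theorem exists_cosPoly_eq (hA : IsStrictReflectionMatrix M A) {r s : S}
    (h : M r s = 3 ∨ M r s = 4 ∨ M r s = 6) :
    ∃ c : ℤ, c ≠ 0 ∧ cosPoly (M r s) = X - C c ∧ A r s * A s r = c := by
  obtain ⟨k, hk1, hk2, hk3, hk⟩ := hA.mul_eq r s (by omega)
  -- For `m` in `{3, 4, 6}` the only `k ≤ m / 2` coprime to `m` is 1, so strictness leaves a single
  -- value of the product: 1, 2 or 3.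
  rcases h with h | h | h <;> rw [h] at hk2 hk3 hk ⊢
  · obtain rfl : k = 1 := by omega
    refine ⟨1, by norm_num, cosPoly_three, ?_⟩
    rw [hk, Nat.cast_one, one_mul, Nat.cast_ofNat, Real.cos_pi_div_three]
    norm_num
  · obtain rfl : k = 1 := by
      have : k ≠ 2 := by rintro rfl; norm_num at hk3
      omega
    refine ⟨2, by norm_num, cosPoly_four, ?_⟩
    rw [hk, Nat.cast_one, one_mul, Nat.cast_ofNat, Real.cos_pi_div_four, div_pow,
      Real.sq_sqrt (by norm_num)]
    norm_num
  · obtain rfl : k = 1 := by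
      have : k ≠ 2 := by rintro rfl; norm_num at hk3
      have : k ≠ 3 := by rintro rfl; norm_num at hk3
      omega
    refine ⟨3, by norm_num, cosPoly_six, ?_⟩
    rw [hk, Nat.cast_one, one_mul, Nat.cast_ofNat, Real.cos_pi_div_six, div_pow,
      Real.sq_sqrt (by norm_num)]
    norm_num

/-- All entries `m_{r,s}` with `r ≠ s` are in `{2, 3, 4, 6}`. -/
def IsCrystallographic (M : CoxeterMatrix S) : Prop :=
  ∀ r s, r ≠ s → M r s ∈ ({2, 3, 4, 6} : Set ℕ)

theorem IsCrystallographic.eq_of_adj (hM : IsCrystallographic M) {r s : S}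
    (h : (coxeterGraph M).Adj r s) : M r s = 3 ∨ M r s = 4 ∨ M r s = 6 := by
  have h' := hM r s h.1
  have := h.2
  simp only [Set.mem_insert_iff, Set.mem_singleton_iff] at h'
  tauto

theorem ne_zero_of_adj (hA : IsStrictReflectionMatrix M A) (hM : IsCrystallographic M) {r s : S}
    (h : (coxeterGraph M).Adj r s) : A r s ≠ 0 := by
  obtain ⟨c, hc, -, e⟩ := exists_cosPoly_eq hA (hM.eq_of_adj h)
  refine left_ne_zero_of_mul (b := A s r) ?_
  rw [e]; exact_mod_cast hc

theorem eq_zero_of_not_adj (hA : IsStrictReflectionMatrix M A) {r s : S} (hrs : r ≠ s)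
    (h : ¬ (coxeterGraph M).Adj r s) : A r s = 0 :=
  hA.eq_zero r s (by by_contra h'; exact h ⟨hrs, h'⟩)

end

/-! ### Reduction of walks to paths, and the isomorphism of `R'` with the matrix algebra -/

section

variable {S : Type*} [Fintype S] {M : CoxeterMatrix S} {A : Matrix S S ℝ}

/-- The class of a walk in `R_{W,S}`. -/
noncomputable def walkClass (M : CoxeterMatrix S) {r s : S} (p : (coxeterGraph M).Walk r s) :
    StrictRing M := toStrictRing M (ofPath ℤ ⟨r, s, p⟩)

theorem walkClass_append {r s t : S} (p : (coxeterGraph M).Walk r s)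
    (q : (coxeterGraph M).Walk s t) :
    walkClass M (p.append q) = walkClass M p * walkClass M q := by
  rw [walkClass, walkClass, walkClass, ← map_mul, ofPath_mul]
  congr 1
  simp [pathMul]
  rfl

/-- This is the defining relation for a linear `C_m = X - c`, with the idempotent `[r]` absorbed
into `[r s]`. -/
theorem edgeR_mul_edgeR (hA : IsStrictReflectionMatrix M A) (hM : IsCrystallographic M) {r s : S}
    (h : (coxeterGraph M).Adj r s) : ∃ c : ℤ, edgeR M r s * edgeR M s r = c • vertexR M r := by
  obtain ⟨c, -, hc, -⟩ := exists_cosPoly_eq hA (hM.eq_of_adj h)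
  refine ⟨c, ?_⟩
  have h2 : toStrictRing M (vertex ℤ r * aeval (edge ℤ r s * edge ℤ s r : CoxeterPathAlgebra M)
      (cosPoly (M r s))) = 0 := by
    have : vertex ℤ r * aeval (edge ℤ r s * edge ℤ s r : CoxeterPathAlgebra M) (cosPoly (M r s))
        ∈ TwoSidedIdeal.span (strictRelations M) :=
      TwoSidedIdeal.subset_span ⟨r, s, by have := hM.eq_of_adj h; omega, rfl⟩
    rw [TwoSidedIdeal.mem_iff] at this
    exact (RingCon.eq _).mpr this
  rw [hc, map_sub, aeval_X, aeval_C, mul_sub, map_sub, ← mul_assoc, vertex_mul_edge, sub_eq_zero,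
    map_mul] at h2
  rw [edgeR, edgeR, h2, map_mul, eq_intCast, map_intCast, zsmul_eq_mul,
    (Int.cast_commute c _).eq, vertexR]

/-- Reduce the tail to a path `p` from `s`, then prepend the edge from `r` to `s`. The result is
again a path unless `p` meets `r`; in a forest `p` must then begin with the step from `s` back to
`r`, and `[r s][s r]` collapses to a multiple of `[r]`. -/
theorem exists_walkClass_eq_smul_of_isPath (hA : IsStrictReflectionMatrix M A)
    (hM : IsCrystallographic M) (hG : (coxeterGraph M).IsAcyclic) {r s : S}
    (w : (coxeterGraph M).Walk r s) :
    ∃ (c : ℤ) (p : (coxeterGraph M).Walk r s), p.IsPath ∧ walkClass M w = c • walkClass M p := by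
  classical
  induction w with
  | nil => exact ⟨1, .nil, .nil, (one_smul _ _).symm⟩
  | @cons r s t h w ih =>
    obtain ⟨c, p, hp, e⟩ := ih
    have e1 : walkClass M (.cons h w) = c • walkClass M (.cons h p) := by
      have e2 := fun q : (coxeterGraph M).Walk s t => walkClass_append (.cons h .nil) q
      simp only [SimpleGraph.Walk.cons_append, SimpleGraph.Walk.nil_append] at e2
      rw [e2, e2, e, mul_smul_comm]
    by_cases hr : r ∈ p.support
    -- Both sides are paths from `s` to `r`, and a forest has at most one.
    · have ht : p.takeUntil r hr = .cons h.symm .nil :=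
        congrArg Subtype.val ((hG.subsingleton_path s r).elim ⟨_, hp.takeUntil hr⟩
          ⟨.cons h.symm .nil, by simpa using h.ne.symm⟩)
      obtain ⟨d, hd⟩ := edgeR_mul_edgeR hA hM h
      refine ⟨c * d, p.dropUntil r hr, hp.dropUntil hr, ?_⟩
      have e3 : walkClass M (.cons h p) = walkClass M (.cons h .nil) *
          (walkClass M (.cons h.symm .nil) * walkClass M (p.dropUntil r hr)) := by
        rw [← walkClass_append, ← ht, p.take_spec hr, ← walkClass_append]
        simp
      have e4 : ∀ {u v : S} (h : (coxeterGraph M).Adj u v),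
          walkClass M (.cons h .nil) = edgeR M u v := by
        intro u v h
        rw [edgeR, edge, dif_pos h, walkClass]
      rw [e1, e3, ← mul_assoc, e4, e4, hd, smul_mul_assoc, mul_smul]
      congr 2
      exact (walkClass_append .nil _).symm
    · exact ⟨c, .cons h p, hp.cons hr, e1⟩

variable [DecidableEq S]

/-- The image of `[r s][s r]` is `(-a_{r,s}) (-a_{s,r}) e_{r,r} = c e_{r,r}`, where `c` is the root
of `C_m`. -/
theorem pathMatrixHom_eq_zero_of_mem (hA : IsStrictReflectionMatrix M A)
    (hM : IsCrystallographic M) {x : CoxeterPathAlgebra M} (hx : x ∈ strictRelations M) :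
    pathMatrixHom A (coxeterGraph M) x = 0 := by
  obtain ⟨r, s, h, rfl⟩ := hx
  have hrs : r ≠ s := ne_of_ne_one M (by omega)
  have hadj : (coxeterGraph M).Adj r s := ⟨hrs, by omega⟩
  obtain ⟨c, -, hc, e⟩ := exists_cosPoly_eq hA (hM.eq_of_adj hadj)
  rw [hc, map_sub, aeval_X, aeval_C, mul_sub, ← mul_assoc, vertex_mul_edge, map_sub, map_mul,
    map_mul, pathMatrixHom_edge A _ (fun h' => absurd hadj h'),
    pathMatrixHom_edge A _ (fun h' => absurd hadj.symm h'), pathMatrixHom_vertex, eq_intCast,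
    map_intCast, Matrix.single_mul_single_same, neg_mul_neg, e, sub_eq_zero,
    ← (Int.cast_commute c _).eq, ← zsmul_eq_mul, Matrix.smul_single]
  simp

/-- The ring homomorphism from `R_{W,S}` to the matrix ring that maps `[s]` to `e_{s,s}` and `[r s]`
to `-a_{r,s} e_{r,s}`. -/
noncomputable def strictRingHom (hA : IsStrictReflectionMatrix M A) (hM : IsCrystallographic M) :
    StrictRing M →+* Matrix S S ℝ :=
  RingCon.lift (TwoSidedIdeal.span (strictRelations M)).ringCon
    (pathMatrixHom A (coxeterGraph M)) <| by
    have : TwoSidedIdeal.span (strictRelations M) ≤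
        TwoSidedIdeal.ker (pathMatrixHom A (coxeterGraph M)) :=
      TwoSidedIdeal.span_le.mpr fun x hx =>
        (TwoSidedIdeal.mem_ker _).mpr (pathMatrixHom_eq_zero_of_mem hA hM hx)
    intro x y hxy
    have := this (TwoSidedIdeal.rel_iff _ x y |>.mp hxy)
    rw [TwoSidedIdeal.mem_ker, map_sub, sub_eq_zero] at this
    exact this

theorem strictRingHom_walkClass (hA : IsStrictReflectionMatrix M A) (hM : IsCrystallographic M)
    {r s : S} (w : (coxeterGraph M).Walk r s) :
    strictRingHom hA hM (walkClass M w) = Matrix.single r s (walkWeight A w) :=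
  pathMatrixHom_ofPath A _

theorem strictRingHom_vertexR (hA : IsStrictReflectionMatrix M A) (hM : IsCrystallographic M)
    (s : S) : strictRingHom hA hM (vertexR M s) = Matrix.single s s 1 :=
  pathMatrixHom_vertex A _ s

theorem strictRingHom_edgeR (hA : IsStrictReflectionMatrix M A) (hM : IsCrystallographic M)
    {r s : S} (h : r ≠ s) : strictRingHom hA hM (edgeR M r s) = Matrix.single r s (-A r s) :=
  pathMatrixHom_edge A _ (eq_zero_of_not_adj hA h)

/-- The extension of `strictRingHom` to `R'`. -/
noncomputable def realStrictRingHom (hA : IsStrictReflectionMatrix M A)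
    (hM : IsCrystallographic M) : RealStrictRing M →ₐ[ℝ] Matrix S S ℝ :=
  Algebra.TensorProduct.lift (Algebra.ofId ℝ _) (strictRingHom hA hM).toIntAlgHom
    fun c _ => Algebra.commute_algebraMap_left c _

theorem realStrictRingHom_tmul (hA : IsStrictReflectionMatrix M A) (hM : IsCrystallographic M)
    (c : ℝ) (x : StrictRing M) :
    realStrictRingHom hA hM (c ⊗ₜ x) = c • strictRingHom hA hM x := by
  exact (Algebra.TensorProduct.lift_tmul _ _ _ c x).trans (Algebra.smul_def c _).symm

/-- A spanning family indexed by `S × S` is sent to nonzero multiples of the matrix units, which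
form a basis of the target. -/
theorem realStrictRingHom_bijective (hA : IsStrictReflectionMatrix M A)
    (hM : IsCrystallographic M) (hG : (coxeterGraph M).IsTree) :
    Function.Bijective (realStrictRingHom hA hM) := by
  choose p hp using fun r s => (hG.connected.preconnected r s).exists_isPath
  set b : S × S → RealStrictRing M := fun i => 1 ⊗ₜ walkClass M (p i.1 i.2)
  have hb : ∀ i, realStrictRingHom hA hM (b i) = Matrix.single i.1 i.2 (walkWeight A (p i.1 i.2)) :=
    fun i => by rw [realStrictRingHom_tmul, one_smul, strictRingHom_walkClass]
  have hw : ∀ i : S × S, walkWeight A (p i.1 i.2) ≠ 0 := fun i =>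
    walkWeight_ne_zero (fun _ _ h => ne_zero_of_adj hA hM h) _
  -- By linearity a single walk suffices; its class is an integer multiple of that of a path, which
  -- is the chosen one by uniqueness in a tree.
  have hspan : ∀ x, x ∈ Submodule.span ℝ (Set.range b) := by
    intro x
    induction x using TensorProduct.induction_on with
    | zero => exact zero_mem _
    | add x y hx hy => exact add_mem hx hy
    | tmul c x =>
      obtain ⟨x, rfl⟩ : ∃ y, toStrictRing M y = x := RingCon.mk'_surjective _ x
      rw [← mul_one c, ← smul_eq_mul, ← TensorProduct.smul_tmul']
      refine Submodule.smul_mem _ c ?_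
      change GraphPath (coxeterGraph M) →₀ ℤ at x
      induction x using Finsupp.induction_linear with
      | zero =>
        have : toStrictRing M (0 : GraphPath (coxeterGraph M) →₀ ℤ) = 0 := map_zero (toStrictRing M)
        rw [this, TensorProduct.tmul_zero]
        exact zero_mem _
      | add x y hx hy =>
        have : toStrictRing M (x + y : GraphPath (coxeterGraph M) →₀ ℤ)
            = toStrictRing M x + toStrictRing M y := map_add (toStrictRing M) x y
        rw [this, TensorProduct.tmul_add]
        exact add_mem hx hy
      | single q n =>
        have : toStrictRing M (Finsupp.single q n : GraphPath (coxeterGraph M) →₀ ℤ)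
            = n • walkClass M q.walk := by
          rw [← Finsupp.smul_single_one]
          exact map_zsmul (toStrictRing M) n _
        obtain ⟨c, w, hw, e⟩ := exists_walkClass_eq_smul_of_isPath hA hM hG.isAcyclic q.walk
        obtain rfl : w = p q.o q.t :=
          congrArg Subtype.val
            ((hG.isAcyclic.subsingleton_path q.o q.t).elim ⟨w, hw⟩ ⟨_, hp q.o q.t⟩)
        rw [this, e, smul_smul, TensorProduct.tmul_smul]
        exact zsmul_mem (Submodule.subset_span (Set.mem_range_self (f := b) (q.o, q.t))) _
  -- The `(i, j)` entry of the image sees only the coefficient of `b (i, j)`. Injectivity and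
  -- surjectivity are both read off from this.
  have hcomb : ∀ (c : S × S → ℝ) (i j : S),
      realStrictRingHom hA hM (∑ k, c k • b k) i j = c (i, j) * walkWeight A (p i j) := by
    intro c i j
    simp [hb, Matrix.sum_apply, Matrix.single_apply, Fintype.sum_prod_type, ite_and]
  constructor
  · rw [injective_iff_map_eq_zero]
    intro x hx
    obtain ⟨c, rfl⟩ := (Submodule.mem_span_range_iff_exists_fun ℝ).mp (hspan x)
    refine Finset.sum_eq_zero fun k _ => ?_
    have := hcomb c k.1 k.2
    rw [hx, Matrix.zero_apply, eq_comm, mul_eq_zero_iff_right (hw k)] at this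
    rw [this, zero_smul]
  · intro B
    refine ⟨∑ k, (B k.1 k.2 / walkWeight A (p k.1 k.2)) • b k, ?_⟩
    ext i j
    rw [hcomb]
    exact div_mul_cancel₀ _ (hw (i, j))

end

section

variable {S W : Type*} [Fintype S] [DecidableEq S] [Group W] {M : CoxeterMatrix S}
  (cs : CoxeterSystem M W) {A : Matrix S S ℝ}

/-! ### Equivariance -/

theorem toMatrix'_rootMap (A : Matrix S S ℝ) (s : S) :
    LinearMap.toMatrix' (rootMap A s) = ∑ r, Matrix.single s r (A r s) := by
  ext i j
  have : LinearMap.toMatrix' (rootMap A s) i j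
      = (pairing A (simpleRoot j) (simpleCoroot s) • simpleRoot s) i := by
    rw [LinearMap.toMatrix'_apply]; rfl
  rw [this, pairing_simple]
  simp [simpleRoot, Matrix.sum_apply, Matrix.single_apply, Pi.single_apply, ite_and, eq_comm]

theorem toMatrix'_corootMap (A : Matrix S S ℝ) (s : S) :
    LinearMap.toMatrix' (corootMap A s) = ∑ r, Matrix.single s r (A s r) := by
  ext i j
  have : LinearMap.toMatrix' (corootMap A s) i j
      = (pairing A (simpleRoot s) (simpleCoroot j) • simpleCoroot s) i := by
    rw [LinearMap.toMatrix'_apply]; rfl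
  rw [this, pairing_simple]
  simp [simpleCoroot, Matrix.sum_apply, Matrix.single_apply, Pi.single_apply, ite_and, eq_comm]

/-- Both sides are row `s` of `A` placed in row `s`: the term `2 [s]` gives the diagonal entry
`a_{s,s} = 2`, and `-[s r]` gives `a_{s,r} e_{s,r}`. -/
theorem strictRingHom_leftRoot (hA : IsStrictReflectionMatrix M A) (hM : IsCrystallographic M)
    (s : S) : strictRingHom hA hM (leftRoot M s) = LinearMap.toMatrix' (corootMap A s) := by
  rw [toMatrix'_corootMap, leftRoot, map_sub, map_mul, map_ofNat, strictRingHom_vertexR, map_sum,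
    ← Finset.add_sum_erase _ _ (Finset.mem_univ s), hA.diag, sub_eq_add_neg,
    ← Finset.sum_neg_distrib]
  congr 1
  · rw [two_mul, ← Matrix.single_add, one_add_one_eq_two]
  · refine Finset.sum_congr rfl fun r hr => ?_
    rw [strictRingHom_edgeR hA hM (Finset.ne_of_mem_erase hr).symm, ← Matrix.single_neg, neg_neg]

/-- Here it is column `s` of `A`. The transpose appears because the right action on `V_A` is
multiplication of row vectors. -/
theorem strictRingHom_rightRoot (hA : IsStrictReflectionMatrix M A) (hM : IsCrystallographic M)
    (s : S) :
    strictRingHom hA hM (rightRoot M s) = (LinearMap.toMatrix' (rootMap A s)).transpose := by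
  rw [toMatrix'_rootMap, rightRoot, map_sub, map_mul, map_ofNat, strictRingHom_vertexR, map_sum,
    ← Finset.add_sum_erase _ _ (Finset.mem_univ s), hA.diag, sub_eq_add_neg,
    ← Finset.sum_neg_distrib, Matrix.transpose_add, Matrix.transpose_sum]
  congr 1
  · rw [Matrix.transpose_single, two_mul, ← Matrix.single_add, one_add_one_eq_two]
  · refine Finset.sum_congr rfl fun r hr => ?_
    rw [strictRingHom_edgeR hA hM (Finset.ne_of_mem_erase hr), ← Matrix.single_neg, neg_neg,
      Matrix.transpose_single]

/-- Both sides are monoid homomorphisms in `w`, so they are compared on simple reflections. -/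
theorem strictRingHom_leftElt (hA : IsStrictReflectionMatrix M A) (hM : IsCrystallographic M)
    (w : W) : strictRingHom hA hM (leftElt cs w) = LinearMap.toMatrix' (corootRep cs hA w) := by
  have : (strictRingHom hA hM : StrictRing M →* Matrix S S ℝ).comp (leftElt cs) =
      { toFun := fun w => LinearMap.toMatrix' (corootRep cs hA w)
        map_one' := by simp
        map_mul' := fun v w => by simp [LinearMap.toMatrix'_mul] } := by
    refine cs.ext_simple fun s => ?_
    simp only [MonoidHom.comp_apply, leftElt, MonoidHom.coe_mk, OneHom.coe_mk, corootRep,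
      CoxeterSystem.lift_apply_simple]
    change strictRingHom hA hM _ = _
    rw [map_sub, map_sub, map_one, strictRingHom_leftRoot, LinearMap.toMatrix'_one]
  exact DFunLike.congr_fun this w

/-- Inversion and transposition each reverse products, so the right-hand side is again
multiplicative in `w`, and simple reflections are their own inverses. -/
theorem strictRingHom_rightElt (hA : IsStrictReflectionMatrix M A) (hM : IsCrystallographic M)
    (w : W) : strictRingHom hA hM (rightElt cs w) =
      (LinearMap.toMatrix' (rootRep cs hA w⁻¹)).transpose := by
  have : (strictRingHom hA hM : StrictRing M →* Matrix S S ℝ).comp (rightElt cs) =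
      { toFun := fun w => (LinearMap.toMatrix' (rootRep cs hA w⁻¹)).transpose
        map_one' := by simp
        map_mul' := fun v w => by simp [LinearMap.toMatrix'_mul] } := by
    refine cs.ext_simple fun s => ?_
    simp only [MonoidHom.comp_apply, rightElt, MonoidHom.coe_mk, OneHom.coe_mk,
      CoxeterSystem.inv_simple, rootRep, CoxeterSystem.lift_apply_simple]
    change strictRingHom hA hM _ = _
    rw [map_sub, map_sub, map_one, strictRingHom_rightRoot, LinearMap.toMatrix'_one,
      Matrix.transpose_sub, Matrix.transpose_one]
  exact DFunLike.congr_fun this w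

theorem realStrictRingHom_biactionR' (hA : IsStrictReflectionMatrix M A)
    (hM : IsCrystallographic M) (g : W × Wᵐᵒᵖ) (x : RealStrictRing M) :
    realStrictRingHom hA hM (biactionR' cs g x) =
      biactionMatrix cs hA g (realStrictRingHom hA hM x) := by
  induction x using TensorProduct.induction_on with
  | zero => simp
  | add x y hx hy => simp only [map_add, hx, hy]
  | tmul c x =>
    have e : biactionR' cs g (c ⊗ₜ x) = c ⊗ₜ (leftElt cs g.1 * (x * rightElt cs g.2.unop)) := rfl
    rw [e, realStrictRingHom_tmul, realStrictRingHom_tmul, map_smul, map_mul, map_mul,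
      strictRingHom_leftElt, strictRingHom_rightElt]
    rfl

/-! ### The identification of `V̌_A ⊗ V_A` with the matrix space -/

/-- The identification `V̌_A ⊗ V_A = Mat_{S×S}(ℝ)` with `α̌_r ⊗ α_s = e_{r,s}`. -/
noncomputable def tensorEquivMatrix (S : Type*) [Fintype S] [DecidableEq S] :
    CorootSpace S ⊗[ℝ] RootSpace S ≃ₗ[ℝ] Matrix S S ℝ :=
  ((Pi.basisFun ℝ S).tensorProduct (Pi.basisFun ℝ S)).equiv (Matrix.stdBasis ℝ S S) (Equiv.refl _)

theorem tensorEquivMatrix_simple (r s : S) :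
    tensorEquivMatrix S (simpleCoroot r ⊗ₜ[ℝ] simpleRoot s) = Matrix.single r s 1 := by
  have := ((Pi.basisFun ℝ S).tensorProduct (Pi.basisFun ℝ S)).equiv_apply
    (b' := Matrix.stdBasis ℝ S S) (r, s) (Equiv.refl _)
  rw [Module.Basis.tensorProduct_apply, Pi.basisFun_apply, Pi.basisFun_apply, Equiv.refl_apply,
    Matrix.stdBasis_eq_single] at this
  exact this

theorem tensorEquivMatrix_tmul (x : CorootSpace S) (y : RootSpace S) :
    tensorEquivMatrix S (x ⊗ₜ[ℝ] y) = Matrix.vecMulVec x y := by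
  have e : (TensorProduct.mk ℝ (CorootSpace S) (RootSpace S)).compr₂
      (tensorEquivMatrix S).toLinearMap = vecMulVecBilin ℝ ℝ := by
    refine (Pi.basisFun ℝ S).ext fun r => (Pi.basisFun ℝ S).ext fun s => ?_
    rw [Pi.basisFun_apply, Pi.basisFun_apply]
    exact (tensorEquivMatrix_simple r s).trans (Matrix.single_eq_single_vecMulVec_single r s)
  exact LinearMap.congr_fun₂ e x y

/-- On rank one matrices this is `P (x yᵀ) Qᵀ = (P x) (Q y)ᵀ`. -/
theorem tensorEquivMatrix_biactionTensor (hA : IsStrictReflectionMatrix M A) (g : W × Wᵐᵒᵖ)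
    (x : CorootSpace S ⊗[ℝ] RootSpace S) :
    tensorEquivMatrix S (biactionTensor cs hA g x) =
      biactionMatrix cs hA g (tensorEquivMatrix S x) := by
  induction x using TensorProduct.induction_on with
  | zero => simp
  | add x y hx hy => simp only [map_add, hx, hy]
  | tmul x y =>
    have e1 : biactionTensor cs hA g (x ⊗ₜ y) =
      corootRep cs hA g.1 x ⊗ₜ rootRep cs hA g.2.unop⁻¹ y := rfl
    have e2 : ∀ B, biactionMatrix cs hA g B = LinearMap.toMatrix' (corootRep cs hA g.1) *
      (B * (LinearMap.toMatrix' (rootRep cs hA g.2.unop⁻¹)).transpose) := fun _ => rfl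
    rw [e1, e2, tensorEquivMatrix_tmul, tensorEquivMatrix_tmul, Matrix.vecMulVec_mul,
      Matrix.mul_vecMulVec, Matrix.vecMul_transpose, LinearMap.toMatrix'_mulVec,
      LinearMap.toMatrix'_mulVec]

theorem exists_equivariant_algEquiv (hA : IsStrictReflectionMatrix M A)
    (hM : IsCrystallographic M) (hG : (coxeterGraph M).IsTree) :
    ∃ (φ : RealStrictRing M ≃ₐ[ℝ] Matrix S S ℝ)
      (ι : CorootSpace S ⊗[ℝ] RootSpace S ≃ₗ[ℝ] Matrix S S ℝ),
      (∀ r s, ι (simpleCoroot r ⊗ₜ[ℝ] simpleRoot s) = Matrix.single r s 1) ∧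
      (∀ (g : W × Wᵐᵒᵖ) (x : RealStrictRing M), φ (biactionR' cs g x) =
        biactionMatrix cs hA g (φ x)) ∧
      (∀ (g : W × Wᵐᵒᵖ) (x : CorootSpace S ⊗[ℝ] RootSpace S),
        ι (biactionTensor cs hA g x) = biactionMatrix cs hA g (ι x)) :=
  ⟨AlgEquiv.ofBijective _ (realStrictRingHom_bijective hA hM hG), tensorEquivMatrix S,
    tensorEquivMatrix_simple, realStrictRingHom_biactionR' cs hA hM,
    tensorEquivMatrix_biactionTensor cs hA⟩

end

/-! ### Finite Weyl groups -/

section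

/-- The cosine is nonnegative and injective on `[0, π / 3]`. This lets `m_{r,s}` be recovered from
`a_{r,s} a_{s,r}`. -/
theorem eq_of_cos_sq_pi_div_eq {m n : ℕ} (hm : 3 ≤ m) (hn : 3 ≤ n)
    (h : Real.cos (Real.pi / m) ^ 2 = Real.cos (Real.pi / n) ^ 2) : m = n := by
  have hpi := Real.pi_pos
  have bounds : ∀ {k : ℕ}, 3 ≤ k → 0 ≤ Real.pi / k ∧ Real.pi / k ≤ Real.pi / 3 := by
    intro k hk
    refine ⟨by positivity, ?_⟩
    gcongr
    exact_mod_cast hk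
  have hcos : ∀ {k : ℕ}, 3 ≤ k → 0 ≤ Real.cos (Real.pi / k) := fun hk =>
    Real.cos_nonneg_of_mem_Icc ⟨by linarith [(bounds hk).1], by linarith [(bounds hk).2]⟩
  have e := Real.injOn_cos ⟨(bounds hm).1, by linarith [(bounds hm).2]⟩
    ⟨(bounds hn).1, by linarith [(bounds hn).2]⟩ ((sq_eq_sq₀ (hcos hm) (hcos hn)).mp h)
  have hm0 : (m : ℝ) ≠ 0 := by positivity
  have hn0 : (n : ℝ) ≠ 0 := by positivity
  rw [div_eq_div_iff hm0 hn0, mul_right_inj' hpi.ne'] at e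
  exact_mod_cast e.symm

theorem cos_pi_div_pos {m : ℕ} (hm : 3 ≤ m) : 0 < Real.cos (Real.pi / m) := by
  have hpi := Real.pi_pos
  have h3 : Real.pi / m ≤ Real.pi / 3 := by
    gcongr
    exact_mod_cast hm
  have h0 : 0 ≤ Real.pi / m := by positivity
  exact Real.cos_pos_of_mem_Ioo ⟨by linarith, by linarith⟩

variable {S W : Type*} [Fintype S] [DecidableEq S] [Group W] {M : CoxeterMatrix S}

/-- If `W` is finite, then `V_A` carries a positive definite symmetric bilinear form, obtained by
averaging, for which the simple reflections are orthogonal. -/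
theorem exists_invariant_form [Finite W] (cs : CoxeterSystem M W)
    {A : Matrix S S ℝ} (hA : IsStrictReflectionMatrix M A) :
    ∃ B : RootSpace S →ₗ[ℝ] RootSpace S →ₗ[ℝ] ℝ, (∀ v w, B v w = B w v) ∧
      (∀ v, v ≠ 0 → 0 < B v v) ∧
      ∀ r s, 2 * B (simpleRoot r) (simpleRoot s) = A r s * B (simpleRoot s) (simpleRoot s) := by
  have := Fintype.ofFinite W
  set B : RootSpace S →ₗ[ℝ] RootSpace S →ₗ[ℝ] ℝ :=
    ∑ g : W, (dotProductBilin ℝ ℝ).compl₁₂ (rootRep cs hA g) (rootRep cs hA g)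
  have hB : ∀ v w, B v w = ∑ g : W, rootRep cs hA g v ⬝ᵥ rootRep cs hA g w := by
    intro v w
    simp [B, LinearMap.sum_apply]
  have hinv : ∀ (h : W) (v w : RootSpace S),
      B (rootRep cs hA h v) (rootRep cs hA h w) = B v w := by
    intro h v w
    rw [hB, hB]
    -- Invariance of the average: reindex by `g ↦ g h`.
    refine Fintype.sum_equiv (Equiv.mulRight h) _ _ fun g => ?_
    simp
  refine ⟨B, fun v w => ?_, fun v hv => ?_, fun r s => ?_⟩
  · rw [hB, hB]
    exact Finset.sum_congr rfl fun g _ => dotProduct_comm _ _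
  · have hpos : ∀ u : S → ℝ, 0 ≤ u ⬝ᵥ u := fun u =>
      Finset.sum_nonneg fun i _ => mul_self_nonneg (u i)
    have hne : v ⬝ᵥ v ≠ 0 := fun h => hv (dotProduct_self_eq_zero.mp h)
    rw [hB]
    refine Finset.sum_pos' (fun g _ => hpos _) ⟨1, Finset.mem_univ _, ?_⟩
    rw [map_one]
    exact lt_of_le_of_ne (hpos v) hne.symm
  -- Since `s α_s = -α_s`, invariance reads `B (α_r - a_{r,s} α_s) (-α_s) = B α_r α_s`.
  · have h := hinv (cs.simple s) (simpleRoot r) (simpleRoot s)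
    rw [rootRep_simple, rootRep_simple, hA.diag] at h
    simp only [map_sub, map_smul, LinearMap.sub_apply, LinearMap.smul_apply, smul_eq_mul] at h
    linarith

theorem simpleRoot_ne_zero {S : Type*} [DecidableEq S] (s : S) : simpleRoot s ≠ 0 := by
  simp [simpleRoot]

/-- For the invariant form, `a_{r,s} a_{s,r} = 4 B(α_r, α_s)² / (B(α_r, α_r) B(α_s, α_s))`, and
strict Cauchy–Schwarz applies to the independent vectors `α_r` and `α_s`. -/
theorem mul_lt_four [Finite W] (cs : CoxeterSystem M W) {A : Matrix S S ℝ}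
    (hA : IsStrictReflectionMatrix M A) {r s : S} (hrs : r ≠ s) : A r s * A s r < 4 := by
  obtain ⟨B, hsymm, hpos, hB⟩ := exists_invariant_form cs hA
  -- This is the component of `α_r` orthogonal to `α_s`; its square length is `(1 - a_{r,s} a_{s,r}
  -- / 4) B(α_r, α_r)`.
  have hv : simpleRoot r - (A r s / 2) • simpleRoot s ≠ 0 := fun h => by
    have := congrFun h r
    simp [simpleRoot, hrs] at this
  have h := hpos _ hv
  simp only [map_sub, map_smul, LinearMap.sub_apply, LinearMap.smul_apply, smul_eq_mul,
    hsymm (simpleRoot s) (simpleRoot r)] at h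
  have h1 := hB r s
  have h2 := hB s r
  rw [hsymm (simpleRoot s) (simpleRoot r)] at h2
  have hr := hpos _ (simpleRoot_ne_zero r)
  by_contra! h4
  have h3 : A r s * A s r * B (simpleRoot r) (simpleRoot r) =
      2 * A r s * B (simpleRoot r) (simpleRoot s) := by rw [mul_assoc, ← h2]; ring
  have h5 := mul_le_mul_of_nonneg_right h4 hr.le
  rw [show B (simpleRoot r) (simpleRoot s) =
    A r s * B (simpleRoot s) (simpleRoot s) / 2 by linarith] at h h3
  linarith

/-- The bound by 4 excludes `m_{r,s} = ∞` (coded as 0). If `m_{r,s} ≥ 3`, the product `a_{r,s}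
a_{s,r}` is an integer strictly between 0 and 4, and 1, 2, 3 are the values of `4 cos² (π / m)` at
`m = 3, 4, 6`. -/
theorem IsCartanMatrix.isCrystallographic [Finite W] (cs : CoxeterSystem M W) {A : Matrix S S ℤ}
    (hA : IsCartanMatrix M A) : IsCrystallographic M := by
  intro r s hrs
  have hlt := mul_lt_four cs hA.isStrictReflectionMatrix hrs
  simp only [Matrix.map_apply] at hlt
  have h1 : M r s ≠ 1 := M.off_diagonal r s hrs
  have h0 : M r s ≠ 0 := fun h => absurd (hA.four_le r s h) (not_le.mpr hlt)
  rcases Nat.lt_or_ge (M r s) 3 with h | h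
  · obtain h : M r s = 2 := by omega
    simp [h]
  have e := hA.mul_eq r s h
  simp only [Matrix.map_apply] at e
  have hpos : (0 : ℝ) < (A r s : ℝ) * A s r := by
    rw [e]
    have := cos_pi_div_pos h
    positivity
  obtain ⟨z, hz⟩ : ∃ z : ℤ, z = A r s * A s r := ⟨_, rfl⟩
  have hz' : (z : ℝ) = (A r s : ℝ) * A s r := by rw [hz]; push_cast; rfl
  rw [← hz'] at hlt hpos e
  have hz0 : 0 < z := by exact_mod_cast hpos
  have hz4 : z < 4 := by exact_mod_cast hlt
  have key : ∀ n : ℕ, 3 ≤ n → (z : ℝ) = 4 * Real.cos (Real.pi / n) ^ 2 → M r s = n :=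
    fun n hn hz => eq_of_cos_sq_pi_div_eq h hn (by linarith)
  simp only [Set.mem_insert_iff, Set.mem_singleton_iff]
  obtain rfl | rfl | rfl : z = 1 ∨ z = 2 ∨ z = 3 := by omega
  · refine .inr (.inl (key 3 le_rfl ?_))
    rw [Nat.cast_ofNat, Real.cos_pi_div_three]
    norm_num
  · refine .inr (.inr (.inl (key 4 (by norm_num) ?_)))
    rw [Nat.cast_ofNat, Real.cos_pi_div_four, div_pow, Real.sq_sqrt (by norm_num)]
    norm_num
  · refine .inr (.inr (.inr (key 6 (by norm_num) ?_)))
    rw [Nat.cast_ofNat, Real.cos_pi_div_six, div_pow, Real.sq_sqrt (by norm_num)]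
    norm_num

/-- Let `v` be the sum of the simple roots scaled to unit length. Distinct unit roots have inner
product at most `-1/2` if adjacent and 0 otherwise, so `0 < B(v, v) ≤ |S| - |E|`. -/
theorem card_edgeSet_lt_card [Finite W] [Nonempty S] (cs : CoxeterSystem M W)
    {A : Matrix S S ℝ} (hA : IsNGCM M A) (hM : IsCrystallographic M) : Nat.card (coxeterGraph M).edgeSet < Nat.card S := by
  classical
  have hA' := hA.isStrictReflectionMatrix
  obtain ⟨B, hsymm, hpos, hB⟩ := exists_invariant_form cs hA'
  set d : S → ℝ := fun s => √(B (simpleRoot s) (simpleRoot s))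
  have hd : ∀ s, 0 < d s := fun s => Real.sqrt_pos.mpr (hpos _ (simpleRoot_ne_zero s))
  have hd2 : ∀ s, B (simpleRoot s) (simpleRoot s) = d s ^ 2 := fun s =>
    (Real.sq_sqrt (hpos _ (simpleRoot_ne_zero s)).le).symm
  -- The cosine of the angle between `α_r` and `α_s`.
  set c : S → S → ℝ := fun r s => (d r)⁻¹ * ((d s)⁻¹ * B (simpleRoot r) (simpleRoot s))
  have hc : ∀ r s, c r s ≤ (if r = s then 1 else 0)
      - 1 / 2 * (if (coxeterGraph M).Adj r s then 1 else 0) := by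
    intro r s
    have hr := (hd r).ne'
    have hs := (hd s).ne'
    have hBrs : 2 * B (simpleRoot r) (simpleRoot s) = A r s * d s ^ 2 := by rw [hB, hd2]
    have hBsr : 2 * B (simpleRoot r) (simpleRoot s) = A s r * d r ^ 2 := by
      rw [hsymm, hB, hd2]
    by_cases hrs : r = s
    · subst hrs
      rw [if_pos rfl, if_neg (SimpleGraph.irrefl _)]
      simp only [c, hd2]
      field_simp
      norm_num
    rw [if_neg hrs]
    split_ifs with h
    · obtain ⟨z, hz0, -, hz⟩ := exists_cosPoly_eq hA' (hM.eq_of_adj h)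
      have hc2 : A r s * A s r = (2 * c r s) ^ 2 := by
        have e1 : A r s = 2 * B (simpleRoot r) (simpleRoot s) / d s ^ 2 := by
          rw [hBrs]; field_simp
        have e2 : A s r = 2 * B (simpleRoot r) (simpleRoot s) / d r ^ 2 := by
          rw [hBsr]; field_simp
        rw [e1, e2]
        simp only [c]
        field_simp
      have hz1 : (1 : ℝ) ≤ z := by
        have h0 : (0 : ℝ) ≤ z := hz ▸ mul_nonneg_of_nonpos_of_nonpos
          (hA.nonpos r s hrs) (hA.nonpos s r (Ne.symm hrs))
        have h0 : 0 ≤ z := by exact_mod_cast h0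
        exact_mod_cast (show 1 ≤ z by omega)
      have hc0 : c r s ≤ 0 := by
        have e : c r s = (d r)⁻¹ * (d s)⁻¹ * (A r s * d s ^ 2 / 2) := by
          rw [← hBrs]; simp only [c]; ring
        rw [e]
        have := hA.nonpos r s hrs
        have hr' := inv_pos.mpr (hd r)
        have hs' := inv_pos.mpr (hd s)
        refine mul_nonpos_of_nonneg_of_nonpos (by positivity) ?_
        have := mul_nonpos_of_nonpos_of_nonneg this (sq_nonneg (d s))
        linarith
      -- From `c ≤ 0` and `(2 c)² = z ≥ 1` it follows that `c ≤ -1/2`.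
      nlinarith
    · have h0 : B (simpleRoot r) (simpleRoot s) = 0 := by
        rw [eq_zero_of_not_adj hA' hrs h] at hBrs
        linarith
      simp [c, h0]
  set v : RootSpace S := ∑ s, (d s)⁻¹ • simpleRoot s
  have hv : v ≠ 0 := fun h => by
    obtain ⟨s⟩ := ‹Nonempty S›
    have := congrFun h s
    simp [v, simpleRoot, Pi.single_apply, (hd s).ne'] at this
  have hBv : B v v = ∑ r, ∑ s, c r s := by
    simp only [v, c, map_sum, LinearMap.sum_apply, map_smul, LinearMap.smul_apply, smul_eq_mul,
      Finset.mul_sum]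
    simp only [hsymm]
  have hlt : 0 < ∑ r, ∑ s, ((if r = s then 1 else 0)
      - 1 / 2 * (if (coxeterGraph M).Adj r s then 1 else 0) : ℝ) :=
    (hBv ▸ hpos v hv).trans_le
      (Finset.sum_le_sum fun r _ => Finset.sum_le_sum fun s _ => hc r s)
  -- Each edge is counted in both orientations, which cancels the factor `1/2`.
  have hedge : ∑ r, ∑ s, (if (coxeterGraph M).Adj r s then 1 else 0 : ℝ)
      = 2 * (coxeterGraph M).edgeFinset.card := by
    have := (coxeterGraph M).two_mul_card_edgeFinset
    rw [← Fintype.sum_prod_type' (f := fun r s => if (coxeterGraph M).Adj r s then (1 : ℝ) else 0),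
      Finset.sum_boole]
    exact_mod_cast this.symm
  simp only [Finset.sum_sub_distrib, ← Finset.mul_sum, hedge] at hlt
  rw [Nat.card_eq_fintype_card, Nat.card_eq_fintype_card, ← SimpleGraph.edgeFinset_card]
  simpa using hlt

/-- Connectedness gives `|S| ≤ |E| + 1`, and positivity of the form gives `|E| < |S|`, so `|E| + 1 =
|S|`. -/
theorem IsCartanMatrix.isTree_coxeterGraph [Finite W] (cs : CoxeterSystem M W)
    {A : Matrix S S ℤ} (hA : IsCartanMatrix M A) (hG : (coxeterGraph M).Connected) :
    (coxeterGraph M).IsTree := by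
  have := hG.nonempty
  have h1 := card_edgeSet_lt_card cs hA (IsCartanMatrix.isCrystallographic cs hA)
  have h2 := hG.card_vert_le_card_edgeSet_add_one
  exact SimpleGraph.isTree_iff_connected_and_card.mpr ⟨hG, by omega⟩

end

end StrictReflection

theorem mainTheorem8 {S W : Type*} [Fintype S] [DecidableEq S] [Group W]
    (M : CoxeterMatrix S) (cs : CoxeterSystem M W) :
    -- `(W, S)` is an irreducible finite Weyl group with Cartan matrix `A`
    (∀ (A : Matrix S S ℤ) (hA : IsCartanMatrix M A), Finite W → (coxeterGraph M).Connected →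
      ∃ (φ : RealStrictRing M ≃ₐ[ℝ] Matrix S S ℝ)
        (ι : CorootSpace S ⊗[ℝ] RootSpace S ≃ₗ[ℝ] Matrix S S ℝ),
        (∀ r s, ι (simpleCoroot r ⊗ₜ[ℝ] simpleRoot s) = Matrix.single r s 1) ∧
        (∀ (g : W × Wᵐᵒᵖ) (x : RealStrictRing M), φ (biactionR' cs g x) =
          biactionMatrix cs hA.isStrictReflectionMatrix g (φ x)) ∧
        (∀ (g : W × Wᵐᵒᵖ) (x : CorootSpace S ⊗[ℝ] RootSpace S),
          ι (biactionTensor cs hA.isStrictReflectionMatrix g x) =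
            biactionMatrix cs hA.isStrictReflectionMatrix g (ι x))) ∧
    -- the Coxeter graph is a tree, all `m_{r,s}` with `r ≠ s` are in `{2, 3, 4, 6}`
    (∀ (A : Matrix S S ℝ) (hA : IsStrictReflectionMatrix M A), (coxeterGraph M).IsTree →
      (∀ r s, r ≠ s → M r s ∈ ({2, 3, 4, 6} : Set ℕ)) →
      ∃ (φ : RealStrictRing M ≃ₐ[ℝ] Matrix S S ℝ)
        (ι : CorootSpace S ⊗[ℝ] RootSpace S ≃ₗ[ℝ] Matrix S S ℝ),
        (∀ r s, ι (simpleCoroot r ⊗ₜ[ℝ] simpleRoot s) = Matrix.single r s 1) ∧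
        (∀ (g : W × Wᵐᵒᵖ) (x : RealStrictRing M), φ (biactionR' cs g x) =
          biactionMatrix cs hA g (φ x)) ∧
        (∀ (g : W × Wᵐᵒᵖ) (x : CorootSpace S ⊗[ℝ] RootSpace S),
          ι (biactionTensor cs hA g x) = biactionMatrix cs hA g (ι x))) :=
  ⟨fun _ hA _ hG => exists_equivariant_algEquiv cs hA.isStrictReflectionMatrix
      (IsCartanMatrix.isCrystallographic cs hA)
      (IsCartanMatrix.isTree_coxeterGraph cs hA hG),
    fun _ hA hG hM => exists_equivariant_algEquiv cs hA hM hG⟩
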